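/- Let $R=\begin{pmatrix}a&b\\c&d\end{pmatrix}$ have nonnegative integer entries with $b\neq 0$, $c\neq 0$ and constant row sum $S=a+b=c+d$; put $m=a-c=d-b$ and $\sigma=m/S$, and assume $\sigma>\tfrac12$. For $(\alpha,\beta)\in\{(1,0),(0,1)\}$ let $(U_{(\alpha,\beta)}(n))_{n\ge 0}$ be the discrete-time two-colour Pólya urn process with replacement matrix $R$ started from $\alpha$ red and $\beta$ black balls: it is the $\mathbb N^2$-valued Markov chain with $U_{(\alpha,\beta)}(0)=(\alpha,\beta)$ that moves from $(x,y)$ to $(x+a,y+b)$ with probability $\frac{x}{x+y}$ (a red ball is drawn) and to $(x+c,y+d)$ with probability $\frac{y}{x+y}$ (a black ball is drawn). Let $u_2(x,y)=\frac1S(bx-cy)$. Then the limits $$X=\lim_{n\to\infty}\frac{u_2\big(U_{(1,0)}(n)\big)}{n^{\sigma}},\qquad Y=\lim_{n\to\infty}\frac{u_2\big(U_{(0,1)}(n)\big)}{n^{\sigma}}$$ exist almost surely in $\mathbb R$, and they satisfy the system of equations in distribution $$X\overset{\mathcal L}{=}\sum_{k=1}^{a+1}V_k^{\sigma}X^{(k)}+\sum_{k=a+2}^{S+1}V_k^{\sigma}Y^{(k)},\qquad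 Y\overset{\mathcal L}{=}\sum_{k=1}^{c}V_k^{\sigma}X^{(k)}+\sum_{k=c+1}^{S+1}V_k^{\sigma}Y^{(k)},$$ where $V=(V_1,\dots,V_{S+1})$ is a Dirichlet distributed random vector with parameters $(\frac1S,\dots,\frac1S)$, the $X^{(k)}$ are copies of $X$ and the $Y^{(k)}$ are copies of $Y$, and all the copies occurring in an equation are independent of each other and of $V$. -/

import Mathlib

open MeasureTheory ProbabilityTheory Filter Topology
open scoped ENNReal

noncomputable section

namespace PolyaUrn

/-- One-step transition probability of the two-colour urn with replacement matrix
`(a b; c d)`, from the composition `u` (red, black) to the composition `v`: a ball is drawn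
uniformly; a red one adds `(a, b)`, a black one adds `(c, d)`. -/
def stepProb (a b c d : ℕ) (u v : ℕ × ℕ) : ℝ≥0∞ :=
  (u.1 : ℝ≥0∞) / ((u.1 : ℝ≥0∞) + (u.2 : ℝ≥0∞)) * (if v = (u.1 + a, u.2 + b) then 1 else 0)
  + (u.2 : ℝ≥0∞) / ((u.1 : ℝ≥0∞) + (u.2 : ℝ≥0∞)) * (if v = (u.1 + c, u.2 + d) then 1 else 0)

/-- `U` is a discrete time two-colour urn process with replacement matrix `(a b; c d)` and
initial composition `u₀`, i.e. the Markov chain started at `u₀` with the transition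
probabilities `stepProb a b c d` (`h` is the history of the urn up to time `n`). -/
structure IsUrnProcess {Ω : Type*} [MeasurableSpace Ω] (a b c d : ℕ) (u₀ : ℕ × ℕ)
    (U : ℕ → Ω → ℕ × ℕ) (μ : Measure Ω) : Prop where
  measurable : ∀ n, Measurable (U n)
  init : ∀ᵐ ω ∂μ, U 0 ω = u₀
  step : ∀ (n : ℕ) (h : ℕ → ℕ × ℕ) (v : ℕ × ℕ),
    μ {ω | (∀ i ≤ n, U i ω = h i) ∧ U (n + 1) ω = v}
      = μ {ω | ∀ i ≤ n, U i ω = h i} * stepProb a b c d (h n) v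

/-- The ratio `σ = m / S` of the eigenvalues `m = a - c` and `S` of the replacement matrix. -/
def ratio (a c S : ℕ) : ℝ := ((a : ℝ) - (c : ℝ)) / (S : ℝ)

/-- The eigenform `u₂(x, y) = (b x - c y) / S`. -/
def u₂ (b c S : ℕ) (u : ℕ × ℕ) : ℝ := ((b : ℝ) * (u.1 : ℝ) - (c : ℝ) * (u.2 : ℝ)) / (S : ℝ)

/-- The normalised projection `u₂(U(n)) / n ^ σ`. -/
def normalized {Ω : Type*} (a b c S : ℕ) (U : ℕ → Ω → ℕ × ℕ) (n : ℕ) (ω : Ω) : ℝ :=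
  u₂ b c S (U n ω) / (n : ℝ) ^ ratio a c S

/-- The limit variable `W = lim u₂(U(n)) / n ^ σ`. -/
def limitW {Ω : Type*} (a b c S : ℕ) (U : ℕ → Ω → ℕ × ℕ) (ω : Ω) : ℝ :=
  limUnder atTop (fun n => normalized a b c S U n ω)

/-- The point `(x₁, …, xₙ, 1 - ∑ xₖ)`. -/
def simplexPoint (n : ℕ) (x : Fin n → ℝ) : Fin (n + 1) → ℝ :=
  Fin.snoc (α := fun _ => ℝ) x (1 - ∑ i, x i)

lemma measurable_simplexPoint (n : ℕ) : Measurable (simplexPoint n) := by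
  refine measurable_pi_iff.2 fun k => ?_
  refine Fin.lastCases ?_ (fun i => ?_) k
  · simp only [simplexPoint, Fin.snoc_last]
    fun_prop
  · simp only [simplexPoint, Fin.snoc_castSucc]
    fun_prop

/-- The measure `dΣ` on the `n`-dimensional simplex in `ℝ ^ (n + 1)`: Lebesgue measure in the
first `n` coordinates. -/
def simplexMeasure (n : ℕ) : Measure (Fin (n + 1) → ℝ) :=
  ((volume : Measure (Fin n → ℝ)).restrict
    {x | (∀ i, x i ∈ Set.Icc (0 : ℝ) 1) ∧ ∑ i, x i ≤ 1}).map (simplexPoint n)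

/-- The Dirichlet distribution with parameters `ν₀, …, νₙ`. -/
def dirichletMeasure {n : ℕ} (ν : Fin (n + 1) → ℝ) : Measure (Fin (n + 1) → ℝ) :=
  (simplexMeasure n).withDensity fun x =>
    ENNReal.ofReal (Real.Gamma (∑ k, ν k) / (∏ k, Real.Gamma (ν k)) * ∏ k, x k ^ (ν k - 1))

/-- `V` is a Dirichlet vector of size `S + 1` with all parameters `1 / S`; among the variables
`Z 0, …, Z S` the first `r` are copies of `X` and the others are copies of `Y`; all the `Z k`
are independent of each other and of `V`. (The index `k : Fin (S + 1)` stands for the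
`(k + 1)`-st variable.) -/
structure IsCopyFamily {Ω Ω₁ Ω₂ : Type*} [MeasurableSpace Ω] [MeasurableSpace Ω₁]
    [MeasurableSpace Ω₂] (S r : ℕ) (X : Ω₁ → ℝ) (μ₁ : Measure Ω₁) (Y : Ω₂ → ℝ)
    (μ₂ : Measure Ω₂) (V : Ω → Fin (S + 1) → ℝ) (Z : Fin (S + 1) → Ω → ℝ)
    (P : Measure Ω) : Prop where
  law_V : HasLaw V (dirichletMeasure fun _ : Fin (S + 1) => 1 / (S : ℝ)) P
  copy_X : ∀ k : Fin (S + 1), (k : ℕ) < r → IdentDistrib (Z k) X P μ₁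
  copy_Y : ∀ k : Fin (S + 1), r ≤ (k : ℕ) → IdentDistrib (Z k) Y P μ₂
  indep_Z : iIndepFun Z P
  indep_V : IndepFun V (fun ω k => Z k ω) P

end PolyaUrn

end

/-! Almost sure convergence is a martingale argument. The form `u₂` is an eigenform: a draw from `n`
balls multiplies its conditional mean by `1 + m / n`. Divided by `growth`, it is a martingale, and
`growth` is asymptotic to a constant times `n ^ σ`. Its second moments stay bounded because `∑ 1 /
growth ^ 2` converges, which is where `σ > 1/2` enters
(`IsUrnProcess.ae_exists_tendsto_normalized`).

The distributional equations are proved on characteristic functions, without constructing a forest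
of independent subtrees. Let `T` be the transition operator and `f` a multiplicative function of the
composition, such as a character of `u₂`. The generating function in `n` of `(s)ₙ / n! * Tⁿ f (x,
y)`, where `s = (x + y) / S`, is the product `F ^ x * H ^ y` of its values at the one-ball
compositions (`coeff_genFun_pow_mul_pow`). Comparing coefficients for `S + 1` balls writes `Tⁿ f` as
an average of `∏ T^(l k) f` over the ways `l` of sharing `n` draws among the families of the balls
(`iterate_transfer_eq_sum`).

The averaging weights are Dirichlet-multinomial: they are the Dirichlet integrals of the multinomial
weights (`integral_multinomialWeight`). For the character with frequency `t / N ^ σ`, the factor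
`T^(l k) f` is uniformly close to the limiting characteristic function at `t * (l k / N) ^ σ`. The
average is therefore close to the Dirichlet integral of a Bernstein operator, which converges to the
integral of the function itself (`charFun_limit_eq_integral`). Conditioning on `V` gives the same
integral for the right-hand side (`IsCopyFamily.charFun_map_sum`). -/

namespace PolyaUrn

/-! ### Transition operator and decomposition along the initial balls -/

/-- The transition operator of the urn, acting on functions of the composition. -/
noncomputable def transfer (a b c d : ℕ) {E : Type*} [NormedAddCommGroup E] [NormedSpace ℝ E]
    (f : ℕ × ℕ → E) (u : ℕ × ℕ) : E :=
  ((u.1 : ℝ) / ((u.1 : ℝ) + (u.2 : ℝ))) • f (u.1 + a, u.2 + b)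
  + ((u.2 : ℝ) / ((u.1 : ℝ) + (u.2 : ℝ))) • f (u.1 + c, u.2 + d)

/-- The weighted iterate `(s)ₙ / n! * Tⁿ f (u)` with `s = (x + y) / S` at `u = (x, y)`. -/
noncomputable def weighted (a b c d S : ℕ) (f : ℕ × ℕ → ℂ) (n : ℕ) (u : ℕ × ℕ) : ℂ :=
  (((ascPochhammer ℝ n).eval (((u.1 : ℝ) + (u.2 : ℝ)) / S) / n.factorial : ℝ) : ℂ)
    * (transfer a b c d)^[n] f u

lemma ascPochhammer_succ_eval_left (n : ℕ) (s : ℝ) :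
    (ascPochhammer ℝ (n + 1)).eval s = s * (ascPochhammer ℝ n).eval (s + 1) := by
  simp [ascPochhammer_succ_left, Polynomial.eval_comp]

section weighted

variable {a b c d S : ℕ} {f : ℕ × ℕ → ℂ}

/-- Balance makes every draw raise `s = (x + y) / S` by exactly one, so `(s)ₙ₊₁ = s * (s + 1)ₙ`, and
the factor `s` cancels the denominator `x + y` of the draw probabilities. The recursion becomes
linear in `x` and `y`, like a derivation applied to `F ^ x * H ^ y`. -/
lemma weighted_succ (hab : a + b = S) (hcd : c + d = S) (hS : S ≠ 0) (n : ℕ) (u : ℕ × ℕ) :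
    weighted a b c d S f (n + 1) u * (n + 1) =
      (u.1 / S : ℂ) * weighted a b c d S f n (u.1 + a, u.2 + b)
      + (u.2 / S : ℂ) * weighted a b c d S f n (u.1 + c, u.2 + d) := by
  obtain ⟨x, y⟩ := u
  have hS' : (S : ℝ) ≠ 0 := by exact_mod_cast hS
  have h1 : (((x + a : ℕ) : ℝ) + ((y + b : ℕ) : ℝ)) / S = ((x : ℝ) + y) / S + 1 := by
    rw [← hab] at hS' ⊢; push_cast at hS' ⊢; field_simp; ring
  have h2 : (((x + c : ℕ) : ℝ) + ((y + d : ℕ) : ℝ)) / S = ((x : ℝ) + y) / S + 1 := by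
    rw [← hcd] at hS' ⊢; push_cast at hS' ⊢; field_simp; ring
  simp only [weighted, Function.iterate_succ_apply', h1, h2, ascPochhammer_succ_eval_left]
  rcases eq_or_ne ((x : ℝ) + y) 0 with h0 | h0
  · have hx : (x : ℝ) = 0 := by
      have := Nat.cast_nonneg (α := ℝ) x; have := Nat.cast_nonneg (α := ℝ) y; linarith
    have hy : (y : ℝ) = 0 := by linarith
    norm_cast at hx hy
    subst hx hy
    simp
  · have hn : ((n : ℂ) + 1) ≠ 0 := by exact_mod_cast n.succ_ne_zero
    have hnf : (n.factorial : ℂ) ≠ 0 := by exact_mod_cast n.factorial_ne_zero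
    have hSc : (S : ℂ) ≠ 0 := by exact_mod_cast hS
    have h0c : (x : ℂ) + y ≠ 0 := by exact_mod_cast h0
    simp only [transfer, Complex.real_smul, Nat.factorial_succ]
    push_cast
    generalize (transfer a b c d)^[n] f (x + a, y + b) = A
    generalize (transfer a b c d)^[n] f (x + c, y + d) = B
    generalize ((Polynomial.eval (((x : ℝ) + y) / S + 1) (ascPochhammer ℝ n) : ℝ) : ℂ) = C
    field_simp

/-- The generating function of the weighted iterates. -/
noncomputable def genFun (a b c d S : ℕ) (f : ℕ × ℕ → ℂ) (u : ℕ × ℕ) : PowerSeries ℂ :=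
  PowerSeries.mk fun n => weighted a b c d S f n u

/-- In the induction below the differential equations for `F` and `H` are known only up to degree
`n`; this lets them be substituted inside a product all the same. -/
lemma coeff_mul_congr {R : Type*} [CommRing R] {n : ℕ} {P Q Q' : PowerSeries R}
    (h : ∀ j ≤ n, PowerSeries.coeff j Q = PowerSeries.coeff j Q') :
    PowerSeries.coeff n (P * Q) = PowerSeries.coeff n (P * Q') := by
  rw [PowerSeries.coeff_mul, PowerSeries.coeff_mul]
  refine Finset.sum_congr rfl fun p hp => ?_
  rw [h _ (by have := Finset.HasAntidiagonal.mem_antidiagonal.1 hp; omega)]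

/-- Multiplicativity of the generating functions in the initial composition. -/
theorem coeff_genFun_pow_mul_pow (hab : a + b = S) (hcd : c + d = S) (hS : S ≠ 0)
    (hf : ∀ x y, f (x, y) = f (1, 0) ^ x * f (0, 1) ^ y) (n : ℕ) :
    ∀ x y, PowerSeries.coeff n
      (genFun a b c d S f (1, 0) ^ x * genFun a b c d S f (0, 1) ^ y)
        = weighted a b c d S f n (x, y) := by
  set F := genFun a b c d S f (1, 0) with hF
  set H := genFun a b c d S f (0, 1) with hH
  induction n using Nat.strong_induction_on with
  | _ n ih =>
  intro x y
  cases n with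
  | zero =>
    simp [hF, hH, genFun, weighted, hf x y]
  | succ n =>
    -- Truncations of the system `F' = F ^ (a + 1) * H ^ b / S`, `H' = F ^ c * H ^ (d + 1) / S`.
    -- They use the induction hypothesis at compositions other than `(x, y)` and in all degrees up
    -- to `n`, hence strong induction with `x`, `y` generalised.
    have hF' : ∀ j ≤ n, PowerSeries.coeff j (PowerSeries.derivative ℂ F)
        = PowerSeries.coeff j (PowerSeries.C (1 / S : ℂ) * (F ^ (a + 1) * H ^ b)) := by
      intro j hj
      rw [PowerSeries.coeff_derivative, PowerSeries.coeff_C_mul, ih j (by omega), hF, genFun,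
        PowerSeries.coeff_mk, weighted_succ hab hcd hS]
      simp [add_comm]
    have hH' : ∀ j ≤ n, PowerSeries.coeff j (PowerSeries.derivative ℂ H)
        = PowerSeries.coeff j (PowerSeries.C (1 / S : ℂ) * (F ^ c * H ^ (d + 1))) := by
      intro j hj
      rw [PowerSeries.coeff_derivative, PowerSeries.coeff_C_mul, ih j (by omega), hH, genFun,
        PowerSeries.coeff_mk, weighted_succ hab hcd hS]
      simp [add_comm]
    have hn : ((n : ℂ) + 1) ≠ 0 := by exact_mod_cast n.succ_ne_zero
    apply mul_right_cancel₀ hn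
    rw [← PowerSeries.coeff_derivative, weighted_succ hab hcd hS, ← ih n (by omega),
      ← ih n (by omega), Derivation.leibniz, PowerSeries.derivative_pow,
      PowerSeries.derivative_pow]
    simp only [smul_eq_mul]
    rw [map_add, ← mul_assoc, coeff_mul_congr hH', ← mul_assoc (H ^ y), coeff_mul_congr hF',
      ← PowerSeries.coeff_C_mul, ← PowerSeries.coeff_C_mul, ← map_add, ← map_add]
    congr 1
    have e1 : (PowerSeries.C (x / S : ℂ) : PowerSeries ℂ) = x * PowerSeries.C (1 / S : ℂ) := by
      rw [div_eq_mul_one_div, map_mul]; simp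
    have e2 : (PowerSeries.C (y / S : ℂ) : PowerSeries ℂ) = y * PowerSeries.C (1 / S : ℂ) := by
      rw [div_eq_mul_one_div, map_mul]; simp
    rw [e1, e2]
    -- The exponents `x - 1` and `y - 1` from the Leibniz rule are truncated, but they come with the
    -- factors `x` and `y`.
    rcases x with _ | x <;> rcases y with _ | y <;> simp <;> ring

/-- The decomposition of an urn started from `S + 1` balls, `r` of them red, along the
families of its initial balls. -/
theorem iterate_transfer_eq_sum (hab : a + b = S) (hcd : c + d = S) (hS : S ≠ 0)
    (hf : ∀ x y, f (x, y) = f (1, 0) ^ x * f (0, 1) ^ y) {r : ℕ} (hr : r ≤ S + 1) (n : ℕ) :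
    (transfer a b c d)^[n] f (r, S + 1 - r) =
      ∑ l ∈ Finset.piAntidiag (Finset.univ : Finset (Fin (S + 1))) n,
        ((Nat.multinomial Finset.univ l *
          ((∏ k, (ascPochhammer ℝ (l k)).eval (1 / S : ℝ)) /
            (ascPochhammer ℝ n).eval (∑ _k : Fin (S + 1), (1 / S : ℝ))) : ℝ) : ℂ) *
        ∏ k : Fin (S + 1),
          (transfer a b c d)^[l k] f (if (k : ℕ) < r then (1, 0) else (0, 1)) := by
  have hS0 : (0 : ℝ) < S := by exact_mod_cast Nat.pos_of_ne_zero hS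
  have hpos : 0 < (ascPochhammer ℝ n).eval (((S : ℝ) + 1) / S) :=
    ascPochhammer_pos n _ (by positivity)
  -- For `S + 1` balls, `s = (S + 1) / S` is the sum of the `S + 1` parameters `1 / S`. This makes
  -- the normalised coefficients Dirichlet-multinomial weights.
  have hsum : (∑ _k : Fin (S + 1), (1 / S : ℝ)) = ((S : ℝ) + 1) / S := by
    simp [div_eq_mul_inv]
  have hprod : genFun a b c d S f (1, 0) ^ r * genFun a b c d S f (0, 1) ^ (S + 1 - r)
      = ∏ k : Fin (S + 1), genFun a b c d S f (if (k : ℕ) < r then (1, 0) else (0, 1)) := by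
    simp only [apply_ite (genFun a b c d S f), Finset.prod_ite, Finset.prod_const]
    have h1 : (Finset.univ.filter fun k : Fin (S + 1) => (k : ℕ) < r).card = r := by
      rw [Fin.card_filter_val_lt]; omega
    have h2 : (Finset.univ.filter fun k : Fin (S + 1) => ¬ (k : ℕ) < r).card = S + 1 - r := by
      have := Finset.card_filter_add_card_filter_not (s := (Finset.univ : Finset (Fin (S + 1))))
        (fun k : Fin (S + 1) => (k : ℕ) < r)
      rw [h1, Finset.card_univ, Fintype.card_fin] at this
      omega
    rw [h1, h2]
  have key := coeff_genFun_pow_mul_pow hab hcd hS hf n r (S + 1 - r)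
  rw [hprod, PowerSeries.coeff_prod] at key
  have hcast : (r : ℝ) + ((S + 1 - r : ℕ) : ℝ) = S + 1 := by
    rw [Nat.cast_sub hr]; push_cast; ring
  have hw : (transfer a b c d)^[n] f (r, S + 1 - r) =
      ((n.factorial / (ascPochhammer ℝ n).eval (((S : ℝ) + 1) / S) : ℝ) : ℂ)
        * weighted a b c d S f n (r, S + 1 - r) := by
    simp only [weighted, hcast]
    rw [← mul_assoc, ← Complex.ofReal_mul]
    have : (n.factorial : ℝ) ≠ 0 := by exact_mod_cast n.factorial_ne_zero
    rw [show ∀ p : ℝ, p ≠ 0 → (n.factorial / p * (p / n.factorial) : ℝ) = 1 by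
      intro p hp; field_simp]
    · simp
    · exact hpos.ne'
  rw [hw, ← key, Finset.mul_sum, hsum]
  refine Finset.sum_nbij' (fun l k => l k) (fun l => Finsupp.equivFunOnFinite.symm l)
    (fun l hl => ?_) (fun l hl => ?_) (fun l _ => by ext; simp) (fun l _ => by ext; simp)
    fun l hl => ?_
  · simpa using (Finset.mem_finsuppAntidiag.1 hl).1
  · simpa [Finset.mem_finsuppAntidiag] using hl
  have hl' : ∑ k, l k = n := (Finset.mem_finsuppAntidiag.1 hl).1
  have hspec := Nat.multinomial_spec (Finset.univ : Finset (Fin (S + 1))) l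
  rw [hl'] at hspec
  have hstart : ∀ k : Fin (S + 1),
      (((if (k : ℕ) < r then ((1, 0) : ℕ × ℕ) else (0, 1)).1 : ℝ)
        + ((if (k : ℕ) < r then ((1, 0) : ℕ × ℕ) else (0, 1)).2 : ℝ)) = 1 := by
    intro k; split_ifs <;> simp
  simp only [genFun, PowerSeries.coeff_mk, weighted, hstart, Finset.prod_mul_distrib,
    ← mul_assoc]
  congr 1
  rw [← Complex.ofReal_prod, ← Complex.ofReal_mul]
  congr 1
  rw [Finset.prod_div_distrib, ← hspec]
  have hne : ((∏ k, (l k).factorial : ℕ) : ℝ) ≠ 0 := by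
    exact_mod_cast Finset.prod_ne_zero_iff.2 fun k _ => (l k).factorial_ne_zero
  push_cast at hne ⊢
  field_simp

end weighted

/-! ### Dirichlet integrals and moments -/

section Dirichlet

/-- The beta integral over `(0, s)`. -/
lemma lintegral_Ioo_rpow_mul_rpow {p q s : ℝ} (hp : 0 < p) (hq : 0 < q) (hs : 0 < s) :
    ∫⁻ x in Set.Ioo 0 s, ENNReal.ofReal (x ^ (p - 1) * (s - x) ^ (q - 1))
      = ENNReal.ofReal (s ^ (p + q - 1) * (Real.Gamma p * Real.Gamma q / Real.Gamma (p + q))) := by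
  have h1 := lintegral_betaPDF_eq_one hp hq
  have hB := beta_pos hp hq
  -- The case `s = 1` is the normalisation of the beta density; the substitution `x ↦ s * x` gives
  -- the rest.
  have e0 : (volume : Measure ℝ) = ENNReal.ofReal |s| • Measure.map (s * ·) volume :=
    (Real.smul_map_volume_mul_left hs.ne').symm
  rw [lintegral_betaPDF] at h1
  have h2 : ∫⁻ x in Set.Ioo (0 : ℝ) 1, ENNReal.ofReal (x ^ (p - 1) * (1 - x) ^ (q - 1))
      = ENNReal.ofReal (beta p q) := by
    have h3 : ∀ x : ℝ, ENNReal.ofReal (1 / beta p q * x ^ (p - 1) * (1 - x) ^ (q - 1))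
        = ENNReal.ofReal (1 / beta p q) * ENNReal.ofReal (x ^ (p - 1) * (1 - x) ^ (q - 1)) := by
      intro x
      rw [← ENNReal.ofReal_mul (by positivity), mul_assoc]
    simp_rw [h3] at h1
    rw [lintegral_const_mul _ (by fun_prop)] at h1
    calc _ = ENNReal.ofReal (beta p q) * (ENNReal.ofReal (1 / beta p q) *
          ∫⁻ x in Set.Ioo (0 : ℝ) 1, ENNReal.ofReal (x ^ (p - 1) * (1 - x) ^ (q - 1))) := by
          rw [← mul_assoc, ← ENNReal.ofReal_mul hB.le, mul_one_div_cancel hB.ne']; simp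
      _ = _ := by rw [h1, mul_one]
  rw [e0, Measure.restrict_smul, lintegral_smul_measure,
    setLIntegral_map measurableSet_Ioo (by fun_prop) (by fun_prop)]
  have e1 : (s * ·) ⁻¹' Set.Ioo 0 s = Set.Ioo (0 : ℝ) 1 := by
    ext x
    simp only [Set.mem_preimage, Set.mem_Ioo]
    constructor
    · rintro ⟨h1, h2⟩; exact ⟨by nlinarith [(mul_pos_iff_of_pos_left hs).1 h1], by nlinarith⟩
    · rintro ⟨h1, h2⟩; exact ⟨mul_pos hs h1, by nlinarith⟩
  rw [e1]
  have e2 : ∀ x ∈ Set.Ioo (0 : ℝ) 1,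
      ENNReal.ofReal ((s * x) ^ (p - 1) * (s - s * x) ^ (q - 1))
      = ENNReal.ofReal (s ^ (p - 1) * s ^ (q - 1))
        * ENNReal.ofReal (x ^ (p - 1) * (1 - x) ^ (q - 1)) := by
    rintro x ⟨hx0, hx1⟩
    rw [← ENNReal.ofReal_mul (by positivity), Real.mul_rpow hs.le hx0.le,
      show s - s * x = s * (1 - x) by ring, Real.mul_rpow hs.le (by linarith)]
    congr 1; ring
  rw [setLIntegral_congr_fun measurableSet_Ioo e2, lintegral_const_mul _ (by fun_prop), h2,
    smul_eq_mul, ← ENNReal.ofReal_mul (by positivity), ← ENNReal.ofReal_mul (by positivity),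
    abs_of_pos hs]
  congr 1
  rw [beta, ← Real.rpow_add hs]
  have : s * s ^ (p - 1 + (q - 1)) = s ^ (p + q - 1) := by
    nth_rewrite 1 [← Real.rpow_one s]
    rw [← Real.rpow_add hs]; congr 1; ring
  rw [← mul_assoc, this]

/-- Dirichlet's integral over the simplex of size `s`. -/
theorem lintegral_simplex (n : ℕ) : ∀ (ν : Fin n → ℝ) (q s : ℝ), (∀ i, 0 < ν i) → 0 < q → 0 < s →
    ∫⁻ x in {x : Fin n → ℝ | (∀ i, 0 ≤ x i) ∧ ∑ i, x i ≤ s},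
      ENNReal.ofReal ((∏ i, x i ^ (ν i - 1)) * (s - ∑ i, x i) ^ (q - 1))
    = ENNReal.ofReal (s ^ (∑ i, ν i + q - 1) *
        ((∏ i, Real.Gamma (ν i)) * Real.Gamma q / Real.Gamma (∑ i, ν i + q))) := by
  have hmeas : ∀ (n : ℕ) (s : ℝ),
      MeasurableSet {x : Fin n → ℝ | (∀ i, 0 ≤ x i) ∧ ∑ i, x i ≤ s} := by
    intro n s
    exact (measurableSet_Ici (a := (0 : Fin n → ℝ))).inter (measurableSet_le
      (by fun_prop : Measurable fun x : Fin n → ℝ => ∑ i, x i) measurable_const)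
  induction n with
  | zero =>
    intro ν q s _ hq hs
    have : {x : Fin 0 → ℝ | (∀ i, 0 ≤ x i) ∧ ∑ i, x i ≤ s} = Set.univ := by
      ext x; simp [hs.le]
    rw [this, Measure.restrict_univ, volume_pi, Measure.pi_of_empty, lintegral_dirac]
    simp [(Real.Gamma_pos_of_pos hq).ne']
  | succ n ih =>
    intro ν q s hν hq hs
    have hp := (volume_preserving_piFinSuccAbove (fun _ : Fin (n + 1) => ℝ) 0).symm
    rw [← lintegral_indicator (hmeas _ _), ← hp.lintegral_comp_emb
      (MeasurableEquiv.measurableEmbedding _), Measure.volume_eq_prod]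
    set g : (Fin (n + 1) → ℝ) → ℝ≥0∞ :=
      fun x => ENNReal.ofReal ((∏ i, x i ^ (ν i - 1)) * (s - ∑ i, x i) ^ (q - 1)) with hg
    have hgm : Measurable g := by fun_prop
    have hcons : ∀ z : ℝ × (Fin n → ℝ),
        (MeasurableEquiv.piFinSuccAbove (fun _ : Fin (n + 1) => ℝ) 0).symm z
          = Fin.cons z.1 z.2 := by
      intro z
      simp [MeasurableEquiv.piFinSuccAbove_symm_apply]
      rfl
    have hgm' : Measurable fun z : ℝ × (Fin n → ℝ) =>
        Set.indicator {x : Fin (n + 1) → ℝ | (∀ i, 0 ≤ x i) ∧ ∑ i, x i ≤ s} g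
          ((MeasurableEquiv.piFinSuccAbove (fun _ : Fin (n + 1) => ℝ) 0).symm z) :=
      (hgm.indicator (hmeas _ _)).comp (MeasurableEquiv.measurable _)
    rw [lintegral_prod _ hgm'.aemeasurable]
    set Q := ∑ i, ν (Fin.succ i) + q with hQ
    have hQ0 : 0 < Q := add_pos_of_nonneg_of_pos (Finset.sum_nonneg fun i _ => (hν _).le) hq
    set K := (∏ i, Real.Gamma (ν (Fin.succ i))) * Real.Gamma q / Real.Gamma Q with hK
    have hK0 : 0 ≤ K := div_nonneg (mul_nonneg
      (Finset.prod_nonneg fun i _ => (Real.Gamma_pos_of_pos (hν _)).le)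
      (Real.Gamma_pos_of_pos hq).le) (Real.Gamma_pos_of_pos hQ0).le
    -- Fix the first coordinate `t`: the others range over a simplex of size `s - t`, which is why
    -- the induction is over all sizes. It contributes `K * (s - t) ^ (Q - 1)` and leaves a beta
    -- integral in `t`. The endpoints `0` and `s` are a null set.
    have hinner : ∀ᵐ t : ℝ, ∫⁻ y : Fin n → ℝ,
        Set.indicator {x : Fin (n + 1) → ℝ | (∀ i, 0 ≤ x i) ∧ ∑ i, x i ≤ s} g
          ((MeasurableEquiv.piFinSuccAbove (fun _ : Fin (n + 1) => ℝ) 0).symm (t, y))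
        = Set.indicator (Set.Ioo 0 s) (fun t => ENNReal.ofReal K *
            ENNReal.ofReal (t ^ (ν 0 - 1) * (s - t) ^ (Q - 1))) t := by
      have hs_ae : ∀ᵐ t : ℝ, t ≠ s := by simp [ae_iff]
      have h0_ae : ∀ᵐ t : ℝ, t ≠ 0 := by simp [ae_iff]
      filter_upwards [hs_ae, h0_ae] with t hts ht0
      by_cases ht : t ∈ Set.Ioo 0 s
      · rw [Set.indicator_of_mem ht]
        have h1 : ∀ y : Fin n → ℝ,
            Set.indicator {x : Fin (n + 1) → ℝ | (∀ i, 0 ≤ x i) ∧ ∑ i, x i ≤ s} g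
              ((MeasurableEquiv.piFinSuccAbove (fun _ : Fin (n + 1) => ℝ) 0).symm (t, y))
            = Set.indicator {y : Fin n → ℝ | (∀ i, 0 ≤ y i) ∧ ∑ i, y i ≤ s - t}
              (fun y => ENNReal.ofReal (t ^ (ν 0 - 1)) * ENNReal.ofReal
                ((∏ i, y i ^ (ν (Fin.succ i) - 1)) * ((s - t) - ∑ i, y i) ^ (q - 1))) y := by
          intro y
          rw [hcons]
          simp only [Set.indicator, Set.mem_ofPred_eq, Fin.forall_fin_succ, Fin.cons_zero,
            Fin.cons_succ, Fin.sum_univ_succ, ht.1.le, true_and, hg, Fin.prod_univ_succ]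
          rw [← ENNReal.ofReal_mul (Real.rpow_nonneg ht.1.le _), sub_add_eq_sub_sub, mul_assoc]
          congr 1
          rw [le_sub_iff_add_le']
        simp_rw [h1]
        rw [lintegral_indicator (hmeas _ _), lintegral_const_mul _ (by fun_prop),
          ih _ _ _ (fun i => hν _) hq (sub_pos.2 ht.2),
          ← ENNReal.ofReal_mul (Real.rpow_nonneg ht.1.le _), ← ENNReal.ofReal_mul hK0]
        congr 1
        ring
      · rw [Set.indicator_of_notMem ht, lintegral_eq_zero_of_ae_eq_zero]
        refine Filter.Eventually.of_forall fun y => ?_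
        beta_reduce
        rw [hcons, Set.indicator_of_notMem, Pi.zero_apply]
        rintro ⟨h1, h2⟩
        rw [Fin.sum_univ_succ] at h2
        have h3 := h1 0
        simp only [Fin.cons_zero, Fin.cons_succ] at h2 h3
        have h4 : 0 ≤ ∑ i, y i := Finset.sum_nonneg fun i _ => by simpa using h1 (Fin.succ i)
        exact ht ⟨lt_of_le_of_ne h3 ht0.symm, lt_of_le_of_ne (by linarith) hts⟩
    rw [lintegral_congr_ae hinner, lintegral_indicator measurableSet_Ioo,
      lintegral_const_mul _ (by fun_prop), lintegral_Ioo_rpow_mul_rpow (hν 0) hQ0 hs,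
      ← ENNReal.ofReal_mul hK0, Fin.sum_univ_succ, Fin.prod_univ_succ]
    congr 1
    rw [hK, add_assoc, ← hQ]
    have := (Real.Gamma_pos_of_pos hQ0).ne'
    field_simp

lemma Gamma_add_natCast {x : ℝ} (hx : 0 < x) (n : ℕ) :
    Real.Gamma (x + n) = (ascPochhammer ℝ n).eval x * Real.Gamma x := by
  induction n with
  | zero => simp
  | succ n ih =>
    push_cast
    rw [← add_assoc, Real.Gamma_add_one (by positivity), ih, ascPochhammer_succ_eval]
    ring

lemma measurableSet_closedSimplex (n : ℕ) :
    MeasurableSet {x : Fin n → ℝ | (∀ i, x i ∈ Set.Icc (0 : ℝ) 1) ∧ ∑ i, x i ≤ 1} := by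
  have h : {x : Fin n → ℝ | (∀ i, x i ∈ Set.Icc (0 : ℝ) 1) ∧ ∑ i, x i ≤ 1}
      = Set.Icc 0 1 ∩ {x | ∑ i, x i ≤ 1} := by
    ext x
    simp [Pi.le_def, forall_and]
  rw [h]
  exact measurableSet_Icc.inter (measurableSet_le
    (by fun_prop : Measurable fun x : Fin n → ℝ => ∑ i, x i) measurable_const)

lemma ae_dirichletMeasure_mem_stdSimplex {n : ℕ} (ν : Fin (n + 1) → ℝ) :
    ∀ᵐ v ∂(dirichletMeasure ν), v ∈ stdSimplex ℝ (Fin (n + 1)) := by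
  suffices h : ∀ᵐ v ∂(simplexMeasure n), v ∈ stdSimplex ℝ (Fin (n + 1)) from
    (withDensity_absolutelyContinuous _ _).ae_le h
  have hm : MeasurableSet (stdSimplex ℝ (Fin (n + 1))) := (isClosed_stdSimplex _ _).measurableSet
  refine (ae_map_iff (measurable_simplexPoint n).aemeasurable hm).2 ?_
  filter_upwards [ae_restrict_mem (measurableSet_closedSimplex n)] with x hx
  refine ⟨fun k => ?_, ?_⟩
  · refine Fin.lastCases ?_ (fun i => ?_) k
    · simpa [simplexPoint] using hx.2
    · simpa [simplexPoint] using (hx.1 i).1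
  · simp [simplexPoint, Fin.sum_univ_castSucc]

/-- A monomial shifts each parameter from `ν k` to `ν k + l k`, so the integral is a ratio of two
Dirichlet normalising constants, and the Gamma quotients collapse to rising factorials. -/
lemma lintegral_dirichletMeasure_monomial {n : ℕ} {ν : Fin (n + 1) → ℝ} (hν : ∀ k, 0 < ν k)
    (l : Fin (n + 1) → ℕ) :
    ∫⁻ v, ENNReal.ofReal (∏ k, v k ^ l k) ∂(dirichletMeasure ν) =
      ENNReal.ofReal ((∏ k, (ascPochhammer ℝ (l k)).eval (ν k)) /
        (ascPochhammer ℝ (∑ k, l k)).eval (∑ k, ν k)) := by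
  have hsum : 0 < ∑ k, ν k := Finset.sum_pos (fun k _ => hν k) Finset.univ_nonempty
  set K := Real.Gamma (∑ k, ν k) / ∏ k, Real.Gamma (ν k) with hK
  have hK0 : 0 ≤ K := div_nonneg (Real.Gamma_pos_of_pos hsum).le
    (Finset.prod_nonneg fun k _ => (Real.Gamma_pos_of_pos (hν k)).le)
  rw [dirichletMeasure, lintegral_withDensity_eq_lintegral_mul _ (by fun_prop) (by fun_prop),
    simplexMeasure, lintegral_map (by fun_prop) (measurable_simplexPoint n)]
  have hset : {x : Fin n → ℝ | (∀ i, x i ∈ Set.Icc (0 : ℝ) 1) ∧ ∑ i, x i ≤ 1}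
      = {x : Fin n → ℝ | (∀ i, 0 ≤ x i) ∧ ∑ i, x i ≤ 1} := by
    ext x
    constructor
    · exact fun h => ⟨fun i => (h.1 i).1, h.2⟩
    · exact fun h => ⟨fun i => ⟨h.1 i, (Finset.single_le_sum (fun j _ => h.1 j)
        (Finset.mem_univ i)).trans h.2⟩, h.2⟩
  -- The boundary value `y = 0` is allowed, so adding real exponents needs a nonzero total; `j ≥ 1`
  -- ensures `p + j - 1 > 0`.
  have hpow : ∀ (p : ℝ) (j : ℕ) (y : ℝ), 0 < p → 0 ≤ y →
      y ^ (p - 1) * y ^ j = y ^ (p + j - 1) := by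
    intro p j y hp hy
    rcases Nat.eq_zero_or_pos j with rfl | hj
    · simp
    · have : (1 : ℝ) ≤ j := by exact_mod_cast hj
      rw [← Real.rpow_natCast y j, ← Real.rpow_add' hy (by linarith)]
      congr 1; ring
  have hfun : ∀ x ∈ {x : Fin n → ℝ | (∀ i, 0 ≤ x i) ∧ ∑ i, x i ≤ 1},
      ((fun x : Fin (n + 1) → ℝ => ENNReal.ofReal (K * ∏ k, x k ^ (ν k - 1)))
        * fun v : Fin (n + 1) → ℝ => ENNReal.ofReal (∏ k, v k ^ l k)) (simplexPoint n x)
      = ENNReal.ofReal K * ENNReal.ofReal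
        ((∏ i, x i ^ ((ν (Fin.castSucc i) + l (Fin.castSucc i)) - 1)) *
          (1 - ∑ i, x i) ^ ((ν (Fin.last n) + l (Fin.last n)) - 1)) := by
    rintro x ⟨hx0, hx1⟩
    have h0 : ∀ k, 0 ≤ simplexPoint n x k := by
      intro k
      refine Fin.lastCases ?_ (fun i => ?_) k
      · simpa [simplexPoint] using hx1
      · simpa [simplexPoint] using hx0 i
    rw [Pi.mul_apply, ENNReal.ofReal_mul hK0, mul_assoc, ← ENNReal.ofReal_mul
      (Finset.prod_nonneg fun k _ => Real.rpow_nonneg (h0 k) _), ← Finset.prod_mul_distrib]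
    simp_rw [fun k => hpow (ν k) (l k) _ (hν k) (h0 k)]
    rw [Fin.prod_univ_castSucc]
    simp [simplexPoint]
  rw [hset, setLIntegral_congr_fun (hset ▸ measurableSet_closedSimplex n) hfun,
    lintegral_const_mul _ (by fun_prop), lintegral_simplex n _ _ 1
      (fun i => by have := hν (Fin.castSucc i); positivity)
      (by have := hν (Fin.last n); positivity) one_pos, ← ENNReal.ofReal_mul hK0]
  congr 1
  have e1 : ∑ i : Fin n, (ν i.castSucc + (l i.castSucc : ℝ)) + (ν (Fin.last n) + l (Fin.last n))
      = ∑ k, ν k + ((∑ k, l k : ℕ) : ℝ) := by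
    rw [← Fin.sum_univ_castSucc (fun k => ν k + (l k : ℝ)), Finset.sum_add_distrib]
    push_cast; rfl
  rw [e1, ← Fin.prod_univ_castSucc (fun k => Real.Gamma (ν k + (l k : ℝ))),
    Gamma_add_natCast hsum, Real.one_rpow, one_mul]
  simp_rw [fun k => Gamma_add_natCast (hν k) (l k)]
  rw [Finset.prod_mul_distrib, hK]
  have h1 := (Real.Gamma_pos_of_pos hsum).ne'
  have h2 : ∏ k, Real.Gamma (ν k) ≠ 0 :=
    Finset.prod_ne_zero_iff.2 fun k _ => (Real.Gamma_pos_of_pos (hν k)).ne'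
  field_simp

/-- The moments of the Dirichlet distribution. -/
theorem integral_dirichletMeasure_monomial {n : ℕ} {ν : Fin (n + 1) → ℝ} (hν : ∀ k, 0 < ν k)
    (l : Fin (n + 1) → ℕ) :
    ∫ v, ∏ k, v k ^ l k ∂(dirichletMeasure ν) =
      (∏ k, (ascPochhammer ℝ (l k)).eval (ν k)) /
        (ascPochhammer ℝ (∑ k, l k)).eval (∑ k, ν k) := by
  have hsum : 0 < ∑ k, ν k := Finset.sum_pos (fun k _ => hν k) Finset.univ_nonempty
  rw [integral_eq_lintegral_of_nonneg_ae, lintegral_dirichletMeasure_monomial hν,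
    ENNReal.toReal_ofReal]
  · exact div_nonneg (Finset.prod_nonneg fun k _ => (ascPochhammer_pos _ _ (hν k)).le)
      (ascPochhammer_pos _ _ hsum).le
  · filter_upwards [ae_dirichletMeasure_mem_stdSimplex ν] with v hv
    exact Finset.prod_nonneg fun k _ => pow_nonneg (hv.1 k) _
  · exact Measurable.aestronglyMeasurable (by fun_prop)

end Dirichlet

/-! ### Bernstein approximation on the simplex -/

section Bernstein

variable {ι : Type*} [Fintype ι]

/-- The weight of `l` under the multinomial distribution with success probabilities `v`. -/
noncomputable def multinomialWeight (v : ι → ℝ) (l : ι → ℕ) : ℝ :=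
  Nat.multinomial Finset.univ l * ∏ k, v k ^ l k

lemma multinomialWeight_nonneg {v : ι → ℝ} (hv : v ∈ stdSimplex ℝ ι) (l : ι → ℕ) :
    0 ≤ multinomialWeight v l :=
  mul_nonneg (Nat.cast_nonneg _) (Finset.prod_nonneg fun k _ => pow_nonneg (hv.1 k) _)

variable [DecidableEq ι]

lemma sum_multinomialWeight {v : ι → ℝ} (hv : v ∈ stdSimplex ℝ ι) (N : ℕ) :
    ∑ l ∈ Finset.piAntidiag Finset.univ N, multinomialWeight v l = 1 := by
  simp only [multinomialWeight]
  rw [← Finset.sum_pow_eq_sum_piAntidiag, hv.2, one_pow]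

open Polynomial in
-- The multinomial theorem with `X` marking the `k`-th coordinate: the marginal is binomial.
lemma sum_multinomialWeight_X_pow {v : ι → ℝ} (hv : v ∈ stdSimplex ℝ ι) (N : ℕ) (k : ι) :
    ∑ l ∈ Finset.piAntidiag Finset.univ N, C (multinomialWeight v l) * (X : ℝ[X]) ^ l k
      = (1 + C (v k) * (X - 1)) ^ N := by
  have h1 : ∑ j, C (v j) * (if j = k then (X : ℝ[X]) else 1) = 1 + C (v k) * (X - 1) := by
    have : ∀ j, C (v j) * (if j = k then (X : ℝ[X]) else 1)
        = C (v j) + (if j = k then C (v j) * (X - 1) else 0) := by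
      intro j; split_ifs <;> ring
    simp_rw [this, Finset.sum_add_distrib, ← map_sum, hv.2]
    simp
  rw [← h1, Finset.sum_pow_eq_sum_piAntidiag]
  refine Finset.sum_congr rfl fun l _ => ?_
  simp only [multinomialWeight, mul_pow, Finset.prod_mul_distrib, ite_pow, one_pow,
    Finset.prod_ite_eq', Finset.mem_univ, if_true, map_mul, map_prod, map_pow, map_natCast]
  ring

/-- The first two derivatives at `1` of the marginal generating polynomial are its factorial
moments, and these determine the variance. -/
lemma sum_multinomialWeight_mul_sq {v : ι → ℝ} (hv : v ∈ stdSimplex ℝ ι) (N : ℕ) (k : ι) :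
    ∑ l ∈ Finset.piAntidiag Finset.univ N, multinomialWeight v l * ((l k : ℝ) - N * v k) ^ 2
      = N * (v k * (1 - v k)) := by
  have h := sum_multinomialWeight_X_pow hv N k
  have h1 := congrArg (fun p => Polynomial.eval 1 (Polynomial.derivative p)) h
  have h2 := congrArg (fun p => Polynomial.eval 1
    (Polynomial.derivative (Polynomial.derivative p))) h
  simp only [Polynomial.derivative_sum, Polynomial.eval_finsetSum] at h1 h2
  simp [Polynomial.derivative_pow] at h1 h2
  have hN : (N : ℝ) * ((N - 1 : ℕ) : ℝ) = N * N - N := by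
    cases N <;> simp; ring
  have hl : ∀ j : ℕ, (j : ℝ) * ((j - 1 : ℕ) : ℝ) = j * j - j := by
    intro j; cases j <;> simp; ring
  have h0 := sum_multinomialWeight hv N
  simp only [hl] at h2
  have e : ∀ l : ι → ℕ, multinomialWeight v l * ((l k : ℝ) - N * v k) ^ 2
      = multinomialWeight v l * ((l k : ℝ) * l k - l k)
        + (1 - 2 * N * v k) * (multinomialWeight v l * l k)
        + (N * v k) ^ 2 * multinomialWeight v l := by
    intro l; ring
  simp_rw [e, Finset.sum_add_distrib, ← Finset.mul_sum]
  rw [h0, h1, h2]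
  linear_combination (v k) ^ 2 * hN

/-- The multivariate Bernstein operator on the simplex. -/
noncomputable def bernsteinSimplex (f : (ι → ℝ) → ℂ) (N : ℕ) (v : ι → ℝ) : ℂ :=
  ∑ l ∈ Finset.piAntidiag Finset.univ N, (multinomialWeight v l : ℂ) * f fun k => l k / N

lemma norm_bernsteinSimplex_le {f : (ι → ℝ) → ℂ} (hf : ∀ x, ‖f x‖ ≤ 1) {v : ι → ℝ}
    (hv : v ∈ stdSimplex ℝ ι) (N : ℕ) : ‖bernsteinSimplex f N v‖ ≤ 1 := by
  rw [← sum_multinomialWeight hv N]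
  refine norm_sum_le_of_le _ fun l _ => ?_
  rw [norm_mul, Complex.norm_real, Real.norm_of_nonneg (multinomialWeight_nonneg hv l)]
  exact mul_le_of_le_one_right (multinomialWeight_nonneg hv l) (hf _)

theorem tendsto_bernsteinSimplex {f : (ι → ℝ) → ℂ} (hf : ∀ x, ‖f x‖ ≤ 1) {v : ι → ℝ}
    (hv : v ∈ stdSimplex ℝ ι) (hfc : ContinuousAt f v) :
    Tendsto (fun N => bernsteinSimplex f N v) atTop (𝓝 (f v)) := by
  rw [Metric.tendsto_atTop]
  intro ε hε
  obtain ⟨δ, hδ, hfδ⟩ := Metric.continuousAt_iff.1 hfc (ε / 2) (half_pos hε)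
  -- Chosen so that the Chebyshev term `2 * card ι / (N * δ ^ 2)` is below `ε / 2` once `N > M`.
  obtain ⟨M, hM⟩ := exists_nat_gt (4 * Fintype.card ι / (δ ^ 2 * ε))
  refine ⟨M + 1, fun N hN => ?_⟩
  have hN0 : (0 : ℝ) < N := by exact_mod_cast (by omega : 0 < N)
  have hMN : (M : ℝ) < N := by exact_mod_cast hN
  -- Either `l / N` is `δ`-close to `v` and continuity applies, or some coordinate is off by at
  -- least `δ`; then the quadratic term is at least `2`, which bounds the difference of two values
  -- of norm at most one.
  have hbound : ∀ l : ι → ℕ, ‖f (fun k => l k / N) - f v‖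
      ≤ ε / 2 + 2 / (N ^ 2 * δ ^ 2) * ∑ k, ((l k : ℝ) - N * v k) ^ 2 := by
    intro l
    have hs : 0 ≤ ∑ k, ((l k : ℝ) - N * v k) ^ 2 := Finset.sum_nonneg fun k _ => sq_nonneg _
    by_cases hd : dist (fun k => (l k : ℝ) / N) v < δ
    · have := (hfδ hd).le
      rw [dist_eq_norm] at this
      have : 0 ≤ 2 / (N ^ 2 * δ ^ 2) * ∑ k, ((l k : ℝ) - N * v k) ^ 2 := by positivity
      linarith
    · rw [dist_pi_lt_iff hδ] at hd
      push Not at hd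
      obtain ⟨k, hk⟩ := hd
      rw [Real.dist_eq] at hk
      have h1 : δ ^ 2 ≤ ((l k : ℝ) / N - v k) ^ 2 := by
        rw [← sq_abs ((l k : ℝ) / N - v k)]
        exact pow_le_pow_left₀ hδ.le hk 2
      have h2 : N ^ 2 * δ ^ 2 ≤ ((l k : ℝ) - N * v k) ^ 2 := by
        calc N ^ 2 * δ ^ 2 ≤ N ^ 2 * ((l k : ℝ) / N - v k) ^ 2 := by gcongr
          _ = _ := by field_simp
      have h3 : N ^ 2 * δ ^ 2 ≤ ∑ k, ((l k : ℝ) - N * v k) ^ 2 :=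
        h2.trans (Finset.single_le_sum (f := fun k => ((l k : ℝ) - N * v k) ^ 2)
          (fun k _ => sq_nonneg _) (Finset.mem_univ k))
      have h4 : 2 ≤ 2 / (N ^ 2 * δ ^ 2) * ∑ k, ((l k : ℝ) - N * v k) ^ 2 := by
        rw [div_mul_eq_mul_div, le_div_iff₀ (by positivity)]
        linarith
      have h5 := norm_sub_le (f fun k => (l k : ℝ) / N) (f v)
      have := hf (fun k => (l k : ℝ) / N)
      have := hf v
      linarith
  have hdiff : bernsteinSimplex f N v - f v = ∑ l ∈ Finset.piAntidiag Finset.univ N,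
      (multinomialWeight v l : ℂ) * (f (fun k => l k / N) - f v) := by
    simp_rw [mul_sub, Finset.sum_sub_distrib, ← Finset.sum_mul, ← Complex.ofReal_sum]
    rw [sum_multinomialWeight hv N]
    simp [bernsteinSimplex]
  have hvar : ∑ k, (N : ℝ) * (v k * (1 - v k)) ≤ N * Fintype.card ι := by
    rw [← Finset.mul_sum]
    gcongr
    rw [← nsmul_one, ← Finset.card_univ, ← Finset.sum_const]
    gcongr with k
    nlinarith [sq_nonneg (v k), hv.1 k]
  calc dist (bernsteinSimplex f N v) (f v)
      ≤ ∑ l ∈ Finset.piAntidiag Finset.univ N, multinomialWeight v l *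
        (ε / 2 + 2 / (N ^ 2 * δ ^ 2) * ∑ k, ((l k : ℝ) - N * v k) ^ 2) := by
        rw [dist_eq_norm, hdiff]
        refine norm_sum_le_of_le _ fun l _ => ?_
        rw [norm_mul, Complex.norm_real, Real.norm_of_nonneg (multinomialWeight_nonneg hv l)]
        exact mul_le_mul_of_nonneg_left (hbound l) (multinomialWeight_nonneg hv l)
    _ = ε / 2 + 2 / (N ^ 2 * δ ^ 2) * ∑ k, (N : ℝ) * (v k * (1 - v k)) := by
        simp_rw [← sum_multinomialWeight_mul_sq hv N, mul_add, Finset.sum_add_distrib,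
          ← Finset.sum_mul, sum_multinomialWeight hv N, one_mul]
        rw [Finset.sum_comm, Finset.mul_sum]
        congr 1
        refine Finset.sum_congr rfl fun l _ => ?_
        rw [← Finset.mul_sum]
        ring
    _ ≤ ε / 2 + 2 / (N ^ 2 * δ ^ 2) * (N * Fintype.card ι) := by gcongr
    _ < ε := by
        have : 2 / (N ^ 2 * δ ^ 2) * (N * Fintype.card ι)
            = 2 * Fintype.card ι / (N * δ ^ 2) := by field_simp
        rw [this]
        have h1 := hM.trans hMN
        rw [div_lt_iff₀ (by positivity)] at h1
        have h2 : 2 * Fintype.card ι / (N * δ ^ 2) < ε / 2 := by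
          rw [div_lt_iff₀ (by positivity)]
          nlinarith
        linarith

end Bernstein

/-! ### Markov property and law of the urn -/

section process

variable {Ω : Type*} [MeasurableSpace Ω] {μ : Measure Ω} {a b c d : ℕ} {u₀ : ℕ × ℕ}
  {U : ℕ → Ω → ℕ × ℕ}

/-- The transition kernel of the urn. -/
noncomputable def stepKernel (a b c d : ℕ) : Kernel (ℕ × ℕ) (ℕ × ℕ) where
  toFun u :=
    ((u.1 : ℝ≥0∞) / ((u.1 : ℝ≥0∞) + (u.2 : ℝ≥0∞))) • Measure.dirac (u.1 + a, u.2 + b)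
    + ((u.2 : ℝ≥0∞) / ((u.1 : ℝ≥0∞) + (u.2 : ℝ≥0∞))) • Measure.dirac (u.1 + c, u.2 + d)
  measurable' := measurable_of_countable _

lemma stepKernel_apply (u : ℕ × ℕ) : stepKernel a b c d u =
    ((u.1 : ℝ≥0∞) / ((u.1 : ℝ≥0∞) + (u.2 : ℝ≥0∞))) • Measure.dirac (u.1 + a, u.2 + b)
    + ((u.2 : ℝ≥0∞) / ((u.1 : ℝ≥0∞) + (u.2 : ℝ≥0∞))) • Measure.dirac (u.1 + c, u.2 + d) := rfl

lemma fst_div_add_le_one (x y : ℕ) : (x : ℝ≥0∞) / ((x : ℝ≥0∞) + (y : ℝ≥0∞)) ≤ 1 :=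
  ENNReal.div_le_of_le_mul (by simp)

lemma snd_div_add_le_one (x y : ℕ) : (y : ℝ≥0∞) / ((x : ℝ≥0∞) + (y : ℝ≥0∞)) ≤ 1 :=
  ENNReal.div_le_of_le_mul (by simp)

/-- The kernel vanishes at `(0, 0)`, where `0 / 0 = 0`, so it is only finite and not Markov. The
bound `2` just adds the two weights. -/
instance : IsFiniteKernel (stepKernel a b c d) := by
  refine ⟨2, by simp, fun u => ?_⟩
  simp only [stepKernel_apply, Measure.add_apply, Measure.smul_apply, measure_univ, smul_eq_mul,
    mul_one]
  rw [← one_add_one_eq_two]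
  exact add_le_add (fst_div_add_le_one _ _) (snd_div_add_le_one _ _)

lemma stepKernel_singleton (u v : ℕ × ℕ) :
    stepKernel a b c d u {v} = stepProb a b c d u v := by
  simp [stepKernel_apply, stepProb, Set.indicator_apply, eq_comm]

lemma integral_stepKernel {E : Type*} [NormedAddCommGroup E] [NormedSpace ℝ E] [CompleteSpace E]
    (f : ℕ × ℕ → E) (u : ℕ × ℕ) :
    ∫ v, f v ∂(stepKernel a b c d u) = transfer a b c d f u := by
  have hi : ∀ (v : ℕ × ℕ), Integrable f (Measure.dirac v) := fun v => integrable_dirac (by simp)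
  have h1 := (fst_div_add_le_one u.1 u.2).trans_lt ENNReal.one_lt_top
  have h2 := (snd_div_add_le_one u.1 u.2).trans_lt ENNReal.one_lt_top
  rw [stepKernel_apply, integral_add_measure ((hi _).smul_measure h1.ne)
    ((hi _).smul_measure h2.ne), integral_smul_measure, integral_smul_measure,
    integral_dirac, integral_dirac, transfer, ENNReal.toReal_div, ENNReal.toReal_div,
    ENNReal.toReal_add (by simp) (by simp)]
  simp

/-- The history of the process up to time `n`. -/
def history (U : ℕ → Ω → ℕ × ℕ) (n : ℕ) (ω : Ω) : Fin (n + 1) → ℕ × ℕ := fun i => U i ω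

lemma IsUrnProcess.measurable_history (hU : IsUrnProcess a b c d u₀ U μ) (n : ℕ) :
    Measurable (history U n) :=
  measurable_pi_lambda _ fun i => hU.measurable i

/-- The space of histories is countable, so it suffices to compare singletons, where the identity is
the defining property `step`. -/
lemma IsUrnProcess.map_history_prod [IsFiniteMeasure μ] (hU : IsUrnProcess a b c d u₀ U μ)
    (n : ℕ) :
    μ.map (fun ω => (history U n ω, U (n + 1) ω)) = (μ.map (history U n)) ⊗ₘ
      ((stepKernel a b c d).comap (fun h : Fin (n + 1) → ℕ × ℕ => h (Fin.last n))
        (measurable_pi_apply _)) := by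
  refine Measure.ext_of_singleton fun p => ?_
  obtain ⟨h, v⟩ := p
  rw [← Set.singleton_prod_singleton, Measure.compProd_apply_prod (measurableSet_singleton _)
    (measurableSet_singleton _), Measure.map_apply
    ((hU.measurable_history n).prodMk (hU.measurable _))
    ((measurableSet_singleton _).prod (measurableSet_singleton _)), lintegral_singleton,
    Measure.map_apply (hU.measurable_history n) (measurableSet_singleton _),
    Kernel.comap_apply, stepKernel_singleton]
  -- `step` takes an infinite history; the values beyond `n` are never read.
  set h' : ℕ → ℕ × ℕ := fun i => if hi : i < n + 1 then h ⟨i, hi⟩ else 0 with hh'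
  have key := hU.step n h' v
  have e0 : ∀ ω, (∀ i ≤ n, U i ω = h' i) ↔ history U n ω = h := by
    intro ω
    rw [funext_iff]
    constructor
    · intro H i
      have := H i (by omega)
      simpa [hh', history, i.is_le] using this
    · intro H i hi
      have := H ⟨i, by omega⟩
      simpa [hh', history, hi] using this
  have e1 : h' n = h (Fin.last n) := by simp [hh', Fin.last]
  simp only [e0, e1] at key
  rw [mul_comm]
  exact key

/-- The Markov property of the urn. -/
theorem IsUrnProcess.setIntegral_succ [IsFiniteMeasure μ] (hU : IsUrnProcess a b c d u₀ U μ)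
    {E : Type*} [NormedAddCommGroup E] [NormedSpace ℝ E] [CompleteSpace E] (f : ℕ × ℕ → E) (n : ℕ)
    (hf : Integrable (fun ω => f (U (n + 1) ω)) μ) (A : Set (Fin (n + 1) → ℕ × ℕ)) :
    ∫ ω in history U n ⁻¹' A, f (U (n + 1) ω) ∂μ
      = ∫ ω in history U n ⁻¹' A, transfer a b c d f (U n ω) ∂μ := by
  have hH := hU.measurable_history n
  have hp : Measurable (fun ω => (history U n ω, U (n + 1) ω)) := hH.prodMk (hU.measurable _)
  have hA : MeasurableSet A := A.to_countable.measurableSet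
  have hA' : MeasurableSet (history U n ⁻¹' A) := hH hA
  set g : (Fin (n + 1) → ℕ × ℕ) × (ℕ × ℕ) → E :=
    fun p => Set.indicator (Prod.fst ⁻¹' A) (fun p => f p.2) p with hg
  have hgm : StronglyMeasurable g := by
    refine StronglyMeasurable.indicator ?_ (measurable_fst hA)
    exact (StronglyMeasurable.of_discrete (f := f)).comp_measurable measurable_snd
  have hgU : (fun ω => g (history U n ω, U (n + 1) ω))
      = Set.indicator (history U n ⁻¹' A) (fun ω => f (U (n + 1) ω)) := by
    rfl
  have hgi : Integrable g (μ.map fun ω => (history U n ω, U (n + 1) ω)) := by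
    rw [integrable_map_measure hgm.aestronglyMeasurable hp.aemeasurable]
    change Integrable (fun ω => g (history U n ω, U (n + 1) ω)) μ
    rw [hgU]
    exact hf.indicator hA'
  rw [← integral_indicator hA', ← hgU, ← integral_map hp.aemeasurable hgm.aestronglyMeasurable,
    hU.map_history_prod, Measure.integral_compProd (by rwa [← hU.map_history_prod]),
    integral_map hH.aemeasurable StronglyMeasurable.of_discrete.aestronglyMeasurable,
    ← integral_indicator hA']
  congr 1
  ext ω
  by_cases hω : history U n ω ∈ A
  · simp [hg, hω, Kernel.comap_apply, integral_stepKernel, history]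
  · simp [hg, hω]

/-- Apply the Markov property to the indicator of the wrong totals: its image under the transition
operator vanishes at every composition with the right total. -/
lemma IsUrnProcess.ae_total [IsFiniteMeasure μ] (hU : IsUrnProcess a b c d u₀ U μ) {S : ℕ}
    (hab : a + b = S) (hcd : c + d = S) (n : ℕ) :
    ∀ᵐ ω ∂μ, (U n ω).1 + (U n ω).2 = u₀.1 + u₀.2 + n * S := by
  induction n with
  | zero => filter_upwards [hU.init] with ω h using by simp [h]
  | succ n ih =>
    set B : Set (ℕ × ℕ) := {u | u.1 + u.2 ≠ u₀.1 + u₀.2 + (n + 1) * S} with hB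
    have hBm : MeasurableSet (U (n + 1) ⁻¹' B) := hU.measurable _ B.to_countable.measurableSet
    have hind : (fun ω => B.indicator (fun _ => (1 : ℝ)) (U (n + 1) ω))
        = (U (n + 1) ⁻¹' B).indicator fun _ => 1 := by
      rfl
    have hi : Integrable (fun ω => B.indicator (fun _ => (1 : ℝ)) (U (n + 1) ω)) μ := by
      rw [hind]
      exact (integrable_const _).indicator hBm
    have h := hU.setIntegral_succ (B.indicator fun _ => (1 : ℝ)) n hi Set.univ
    simp only [Set.preimage_univ, Measure.restrict_univ] at h
    rw [hind, integral_indicator_const _ hBm, integral_eq_zero_of_ae] at h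
    · have h0 : μ (U (n + 1) ⁻¹' B) = 0 := by
        simpa [Measure.real, ENNReal.toReal_eq_zero_iff] using h
      filter_upwards [compl_mem_ae_iff.2 h0] with ω hω
      simpa [hB] using hω
    · filter_upwards [ih] with ω hω
      have h1 : ((U n ω).1 + a, (U n ω).2 + b) ∉ B := by
        simp only [hB, Set.mem_ofPred_eq, not_not]; rw [add_mul]; omega
      have h2 : ((U n ω).1 + c, (U n ω).2 + d) ∉ B := by
        simp only [hB, Set.mem_ofPred_eq, not_not]; rw [add_mul]; omega
      simp [transfer, h1, h2]

/-- The total bounds both coordinates, so at a fixed time almost surely only finitely many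
compositions occur. -/
lemma IsUrnProcess.integrable_comp [IsFiniteMeasure μ] (hU : IsUrnProcess a b c d u₀ U μ) {S : ℕ}
    (hab : a + b = S) (hcd : c + d = S) {E : Type*} [NormedAddCommGroup E] (f : ℕ × ℕ → E)
    (n : ℕ) : Integrable (fun ω => f (U n ω)) μ := by
  set N := u₀.1 + u₀.2 + n * S + 1 with hN
  refine Integrable.of_bound (C := ∑ u ∈ Finset.range N ×ˢ Finset.range N, ‖f u‖)
    ((StronglyMeasurable.of_discrete (f := f)).comp_measurable
      (hU.measurable n)).aestronglyMeasurable ?_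
  filter_upwards [hU.ae_total hab hcd n] with ω hω
  refine Finset.single_le_sum (f := fun u => ‖f u‖) (fun u _ => norm_nonneg _) ?_
  rw [Finset.mem_product, Finset.mem_range, Finset.mem_range]
  omega

/-- The law of the urn at time `n` through the iterates of the transition operator. -/
theorem IsUrnProcess.integral_comp [IsProbabilityMeasure μ] (hU : IsUrnProcess a b c d u₀ U μ)
    {S : ℕ} (hab : a + b = S) (hcd : c + d = S) {E : Type*} [NormedAddCommGroup E]
    [NormedSpace ℝ E] [CompleteSpace E] (n : ℕ) :
    ∀ f : ℕ × ℕ → E, ∫ ω, f (U n ω) ∂μ = (transfer a b c d)^[n] f u₀ := by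
  induction n with
  | zero =>
    intro f
    rw [integral_congr_ae (g := fun _ => f u₀) (hU.init.mono fun ω h => by simp [h])]
    simp
  | succ n ih =>
    intro f
    have h := hU.setIntegral_succ f n (hU.integrable_comp hab hcd f _) Set.univ
    simp only [Set.preimage_univ, Measure.restrict_univ] at h
    rw [h, ih, Function.iterate_succ_apply]

end process

/-! ### Asymptotics of the growth factor -/

section growth

/-- The growth factor of the mean of the eigenform `u₂`. -/
noncomputable def growth (m : ℝ) (S n : ℕ) : ℝ := ∏ j ∈ Finset.range n, (1 + m / (1 + j * S))

variable {m : ℝ} {S : ℕ}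

lemma growth_succ (n : ℕ) : growth m S (n + 1) = growth m S n * (1 + m / (1 + n * S)) :=
  Finset.prod_range_succ _ _

lemma growth_pos (hm : 0 ≤ m) (n : ℕ) : 0 < growth m S n :=
  Finset.prod_pos fun j _ => by positivity

/-- Each factor is `((1 + m) / S + j) / (1 / S + j)`, so Euler's product for Gamma appears twice.
That product has `n + 1` factors, hence the shifted index. -/
lemma growth_succ_eq_GammaSeq (hm : 0 ≤ m) (hS : S ≠ 0) {n : ℕ} (hn : n ≠ 0) :
    growth m S (n + 1) / (n : ℝ) ^ (m / S)
      = Real.GammaSeq (1 / S) n / Real.GammaSeq ((1 + m) / S) n := by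
  have hS0 : (0 : ℝ) < S := by exact_mod_cast Nat.pos_of_ne_zero hS
  have hn0 : (0 : ℝ) < n := by exact_mod_cast Nat.pos_of_ne_zero hn
  have h1 : growth m S (n + 1) = (∏ j ∈ Finset.range (n + 1), ((1 + m) / S + j : ℝ)) /
      ∏ j ∈ Finset.range (n + 1), (1 / S + j : ℝ) := by
    rw [growth, ← Finset.prod_div_distrib]
    refine Finset.prod_congr rfl fun j _ => ?_
    have : (1 + j * S : ℝ) ≠ 0 := by positivity
    field_simp
    ring
  have hp1 : ∏ j ∈ Finset.range (n + 1), (1 / S + j : ℝ) ≠ 0 :=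
    (Finset.prod_pos fun j _ => by positivity).ne'
  have hp2 : ∏ j ∈ Finset.range (n + 1), ((1 + m) / S + j : ℝ) ≠ 0 :=
    (Finset.prod_pos fun j _ => by positivity).ne'
  have hpow : (n : ℝ) ^ ((1 + m) / S) = (n : ℝ) ^ (1 / S : ℝ) * (n : ℝ) ^ (m / S) := by
    rw [← Real.rpow_add hn0, add_div]
  have hf : (n.factorial : ℝ) ≠ 0 := by exact_mod_cast n.factorial_ne_zero
  have hr1 : (n : ℝ) ^ (1 / S : ℝ) ≠ 0 := (Real.rpow_pos_of_pos hn0 _).ne'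
  have hr2 : (n : ℝ) ^ (m / S : ℝ) ≠ 0 := (Real.rpow_pos_of_pos hn0 _).ne'
  rw [h1, Real.GammaSeq, Real.GammaSeq, hpow]
  generalize ∏ j ∈ Finset.range (n + 1), (1 / S + j : ℝ) = A at *
  generalize ∏ j ∈ Finset.range (n + 1), ((1 + m) / S + j : ℝ) = B at *
  generalize (n : ℝ) ^ (1 / S : ℝ) = p at *
  field_simp

lemma exists_tendsto_growth_div_rpow (hm : 0 ≤ m) (hS : S ≠ 0) :
    ∃ C : ℝ, 0 < C ∧ Tendsto (fun n : ℕ => growth m S n / (n : ℝ) ^ (m / S)) atTop (𝓝 C) := by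
  have hS0 : (0 : ℝ) < S := by exact_mod_cast Nat.pos_of_ne_zero hS
  have hG1 : 0 < Real.Gamma (1 / S) := Real.Gamma_pos_of_pos (by positivity)
  have hG2 : 0 < Real.Gamma ((1 + m) / S) := Real.Gamma_pos_of_pos (by positivity)
  refine ⟨Real.Gamma (1 / S) / Real.Gamma ((1 + m) / S), div_pos hG1 hG2, ?_⟩
  have h1 : Tendsto (fun n : ℕ => growth m S (n + 1) / (n : ℝ) ^ (m / S)) atTop
      (𝓝 (Real.Gamma (1 / S) / Real.Gamma ((1 + m) / S))) := by
    refine ((Real.GammaSeq_tendsto_Gamma _).div (Real.GammaSeq_tendsto_Gamma _) hG2.ne').congr' ?_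
    filter_upwards [eventually_ne_atTop 0] with n hn
    exact (growth_succ_eq_GammaSeq hm hS hn).symm
  have h2 : Tendsto (fun n : ℕ => 1 + m / (1 + (n : ℝ) * S)) atTop (𝓝 (1 + 0)) := by
    refine tendsto_const_nhds.add (tendsto_const_nhds.div_atTop ?_)
    exact tendsto_atTop_add_const_left _ _ (tendsto_natCast_atTop_atTop.atTop_mul_const hS0)
  have h3 := h1.div h2 (by norm_num)
  rw [add_zero, div_one] at h3
  refine h3.congr fun n => ?_
  have : (1 + m / (1 + (n : ℝ) * S)) ≠ 0 := by positivity
  simp only [Pi.div_apply]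
  rw [growth_succ]
  field_simp

/-- The terms are comparable to `n ^ (-2σ)`, which is summable exactly because `σ > 1/2`. The later
arguments on laws need only `σ > 0`. -/
lemma summable_inv_growth_sq (hm : 0 ≤ m) (hS : S ≠ 0) (hσ : 1 / 2 < m / S) :
    Summable fun n : ℕ => 1 / growth m S n ^ 2 := by
  obtain ⟨C, hC, h⟩ := exists_tendsto_growth_div_rpow hm hS
  have hsum : Summable fun n : ℕ => 1 / (n : ℝ) ^ (2 * (m / S)) :=
    Real.summable_one_div_nat_rpow.2 (by linarith)
  refine summable_of_isBigO_nat hsum ?_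
  refine Asymptotics.IsBigO.of_bound ((2 / C) ^ 2) ?_
  filter_upwards [h.eventually (lt_mem_nhds (half_lt_self hC)), eventually_ne_atTop 0] with n hn hn0
  have hn1 : (0 : ℝ) < n := by exact_mod_cast Nat.pos_of_ne_zero hn0
  have hr := Real.rpow_pos_of_pos hn1 (m / S)
  have hg := growth_pos (S := S) hm n
  rw [lt_div_iff₀ hr] at hn
  rw [Real.norm_of_nonneg (by positivity), Real.norm_of_nonneg (by positivity), mul_comm 2,
    Real.rpow_mul hn1.le, Real.rpow_two]
  rw [show (2 / C) ^ 2 * (1 / ((n : ℝ) ^ (m / S)) ^ 2) = 1 / (C / 2 * (n : ℝ) ^ (m / S)) ^ 2 by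
    field_simp]
  exact one_div_le_one_div_of_le (by positivity) (by gcongr)

end growth

/-! ### The martingale and almost sure convergence -/

section convergence

variable {Ω : Type*} [MeasurableSpace Ω] {μ : Measure Ω} {a b c d S : ℕ} {u₀ : ℕ × ℕ}
  {U : ℕ → Ω → ℕ × ℕ}

lemma transfer_u₂ (hab : a + b = S) (hcd : c + d = S) (u : ℕ × ℕ) :
    transfer a b c d (u₂ b c S) u
      = u₂ b c S u * (((u.1 : ℝ) + u.2 + ((a : ℝ) - c)) / ((u.1 : ℝ) + u.2)) := by
  obtain ⟨x, y⟩ := u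
  have hd : (d : ℝ) = a + b - c := by
    have : (c : ℝ) + d = a + b := by exact_mod_cast hcd.trans hab.symm
    linarith
  rcases eq_or_ne ((x : ℝ) + y) 0 with h0 | h0
  · simp [transfer, h0]
  · simp only [transfer, u₂, smul_eq_mul]
    push_cast
    rw [hd, ← mul_div_assoc, div_mul_div_comm]
    rcases eq_or_ne (S : ℝ) 0 with hS | hS
    · simp [hS]
    · field_simp
      ring

/-- The second moment after a draw is the squared mean plus the variance of the increment. The
increment takes two fixed values `p`, `q`, so its variance `t1 * t2 * (p - q) ^ 2` is at most `p ^ 2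
+ q ^ 2`, whatever the composition. -/
lemma transfer_u₂_sq (hab : a + b = S) (hcd : c + d = S) (u : ℕ × ℕ) :
    transfer a b c d (fun v => u₂ b c S v ^ 2) u
      ≤ u₂ b c S u ^ 2 * (((u.1 : ℝ) + u.2 + ((a : ℝ) - c)) / ((u.1 : ℝ) + u.2)) ^ 2
        + (u₂ b c S (a, b) ^ 2 + u₂ b c S (c, d) ^ 2) := by
  obtain ⟨x, y⟩ := u
  have hadd : ∀ p q : ℕ, u₂ b c S (x + p, y + q) = u₂ b c S (x, y) + u₂ b c S (p, q) := by
    intro p q; simp only [u₂]; push_cast; ring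
  have hx : (0 : ℝ) ≤ x := Nat.cast_nonneg x
  have hy : (0 : ℝ) ≤ y := Nat.cast_nonneg y
  rcases eq_or_ne ((x : ℝ) + y) 0 with h0 | h0
  · simp only [transfer, h0, div_zero, zero_smul, add_zero]
    positivity
  · have hpos : 0 < (x : ℝ) + y := lt_of_le_of_ne (by positivity) h0.symm
    have h1 := transfer_u₂ hab hcd (x, y)
    simp only [transfer, hadd, smul_eq_mul] at h1 ⊢
    set w := u₂ b c S (x, y)
    set p := u₂ b c S (a, b)
    set q := u₂ b c S (c, d)
    have hs : (x : ℝ) / (x + y) + (y : ℝ) / (x + y) = 1 := by field_simp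
    have ht1 : 0 ≤ (x : ℝ) / (x + y) := by positivity
    have ht2 : 0 ≤ (y : ℝ) / (x + y) := by positivity
    set t1 := (x : ℝ) / (x + y)
    set t2 := (y : ℝ) / (x + y)
    rw [← mul_pow, ← h1]
    have : t2 = 1 - t1 := by linarith
    have e : t1 * (w + p) ^ 2 + t2 * (w + q) ^ 2
        = (t1 * (w + p) + t2 * (w + q)) ^ 2 + t1 * t2 * (p - q) ^ 2 := by
      rw [this]; ring
    have hq : t1 * t2 * (p - q) ^ 2 ≤ p ^ 2 + q ^ 2 := by
      have h4 : 4 * (t1 * t2) ≤ 1 := by rw [this]; nlinarith [sq_nonneg (2 * t1 - 1)]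
      have h5 : (p - q) ^ 2 ≤ 2 * (p ^ 2 + q ^ 2) := by nlinarith [sq_nonneg (p + q)]
      nlinarith [mul_nonneg ht1 ht2, sq_nonneg (p - q), sq_nonneg p, sq_nonneg q]
    linarith

/-- The filtration of the histories of the urn. -/
def historyFiltration (U : ℕ → Ω → ℕ × ℕ) (hU : ∀ n, Measurable (U n)) :
    Filtration ℕ (inferInstance : MeasurableSpace Ω) where
  seq n := MeasurableSpace.comap (history U n) inferInstance
  mono' := by
    intro i j hij
    have h : history U i = (fun h : Fin (j + 1) → ℕ × ℕ =>
        fun k : Fin (i + 1) => h (Fin.castLE (by omega) k)) ∘ history U j := rfl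
    change MeasurableSpace.comap _ _ ≤ MeasurableSpace.comap _ _
    rw [h, ← MeasurableSpace.comap_comp]
    exact MeasurableSpace.comap_mono (measurable_of_countable _).comap_le
  le' n := (measurable_pi_lambda _ fun i : Fin (n + 1) => hU i : Measurable (history U n)).comap_le

/-- The normalised eigenform along the urn. -/
noncomputable def urnMartingale (a b c S : ℕ) (U : ℕ → Ω → ℕ × ℕ) (n : ℕ) (ω : Ω) : ℝ :=
  u₂ b c S (U n ω) / growth ((a : ℝ) - c) S n

variable [IsProbabilityMeasure μ]

theorem IsUrnProcess.martingale (hU : IsUrnProcess a b c d u₀ U μ) (hab : a + b = S)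
    (hcd : c + d = S) (hu₀ : u₀.1 + u₀.2 = 1) (hm : (0 : ℝ) ≤ (a : ℝ) - c) :
    Martingale (urnMartingale a b c S U) (historyFiltration U hU.measurable) μ := by
  refine martingale_of_setIntegral_eq_succ (fun n => ?_)
    (fun n => (hU.integrable_comp hab hcd (u₂ b c S) n).div_const _) fun n s hs => ?_
  · have h : urnMartingale a b c S U n = (fun h : Fin (n + 1) → ℕ × ℕ =>
        u₂ b c S (h (Fin.last n)) / growth ((a : ℝ) - c) S n) ∘ history U n := rfl
    rw [h]
    exact ((measurable_of_countable _).comp (comap_measurable _)).stronglyMeasurable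
  · obtain ⟨A, -, rfl⟩ := hs
    simp only [urnMartingale]
    rw [integral_div, integral_div, hU.setIntegral_succ _ _ (hU.integrable_comp hab hcd _ _),
      growth_succ]
    have h1 : ∫ ω in history U n ⁻¹' A, transfer a b c d (u₂ b c S) (U n ω) ∂μ
        = ∫ ω in history U n ⁻¹' A,
            u₂ b c S (U n ω) * (1 + ((a : ℝ) - c) / (1 + n * S)) ∂μ := by
      refine integral_congr_ae (ae_restrict_of_ae ?_)
      filter_upwards [hU.ae_total hab hcd n] with ω hω
      rw [transfer_u₂ hab hcd]
      have h2 : ((U n ω).1 : ℝ) + (U n ω).2 = 1 + n * S := by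
        rw [hu₀] at hω; exact_mod_cast hω
      rw [h2]
      have : (1 + n * S : ℝ) ≠ 0 := by positivity
      field_simp
    rw [h1, integral_mul_const]
    have : 1 + ((a : ℝ) - c) / (1 + n * S) ≠ 0 := by positivity
    field_simp

/-- After normalisation the mean part is preserved, and the step to time `n + 1` adds at most the
variance bound over `growth (n + 1) ^ 2`. -/
lemma IsUrnProcess.integral_urnMartingale_sq_le (hU : IsUrnProcess a b c d u₀ U μ)
    (hab : a + b = S) (hcd : c + d = S) (hu₀ : u₀.1 + u₀.2 = 1) (hm : (0 : ℝ) ≤ (a : ℝ) - c)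
    (n : ℕ) :
    ∫ ω, urnMartingale a b c S U n ω ^ 2 ∂μ ≤ u₂ b c S u₀ ^ 2
      + (u₂ b c S (a, b) ^ 2 + u₂ b c S (c, d) ^ 2) *
        ∑ j ∈ Finset.range (n + 1), 1 / growth ((a : ℝ) - c) S j ^ 2 := by
  set K := u₂ b c S (a, b) ^ 2 + u₂ b c S (c, d) ^ 2 with hK
  have hsq : ∀ n, Integrable (fun ω => u₂ b c S (U n ω) ^ 2) μ :=
    fun n => hU.integrable_comp hab hcd (fun v => u₂ b c S v ^ 2) n
  induction n with
  | zero =>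
    have h0 : ∫ ω, urnMartingale a b c S U 0 ω ^ 2 ∂μ = u₂ b c S u₀ ^ 2 := by
      rw [integral_congr_ae (g := fun _ => u₂ b c S u₀ ^ 2)
        (hU.init.mono fun ω h => by simp [urnMartingale, growth, h])]
      simp
    rw [h0]
    have : 0 ≤ K * ∑ j ∈ Finset.range (0 + 1), 1 / growth ((a : ℝ) - c) S j ^ 2 :=
      mul_nonneg (by positivity) (Finset.sum_nonneg fun j _ => by positivity)
    linarith
  | succ n ih =>
    rw [Finset.sum_range_succ, mul_add, ← add_assoc]
    refine le_trans ?_ (add_le_add_left ih _)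
    set r := 1 + ((a : ℝ) - c) / (1 + n * S) with hr
    have hr0 : 0 < r := by positivity
    have hg := growth_pos (S := S) hm n
    have hstep : ∫ ω, u₂ b c S (U (n + 1) ω) ^ 2 ∂μ
        ≤ r ^ 2 * ∫ ω, u₂ b c S (U n ω) ^ 2 ∂μ + K := by
      have h := hU.setIntegral_succ (fun v => u₂ b c S v ^ 2) n (hsq _) Set.univ
      simp only [Set.preimage_univ, Measure.restrict_univ] at h
      rw [h, ← integral_const_mul]
      have hc : K = ∫ _ω : Ω, K ∂μ := by simp
      rw [hc, ← integral_add ((hsq n).const_mul _) (integrable_const _)]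
      refine integral_mono_ae (hU.integrable_comp hab hcd _ n)
        (((hsq n).const_mul _).add (integrable_const _)) ?_
      filter_upwards [hU.ae_total hab hcd n] with ω hω
      refine (transfer_u₂_sq hab hcd _).trans_eq ?_
      have h2 : ((U n ω).1 : ℝ) + (U n ω).2 = 1 + n * S := by
        rw [hu₀] at hω; exact_mod_cast hω
      have : (1 + n * S : ℝ) ≠ 0 := by positivity
      rw [h2, hr, add_div, div_self this]
      simp only [← hK]
      ring
    simp only [urnMartingale, div_pow]
    rw [integral_div, integral_div, growth_succ, ← hr]
    rw [div_le_iff₀ (by positivity)]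
    refine hstep.trans_eq ?_
    field_simp

/-- The second-moment bound gives an `L¹` bound through `|x| ≤ 1 + x ^ 2`, and Doob's theorem
applies; the asymptotics of `growth` then replace it by `n ^ σ`. -/
theorem IsUrnProcess.ae_exists_tendsto_normalized (hU : IsUrnProcess a b c d u₀ U μ)
    (hab : a + b = S) (hcd : c + d = S) (hu₀ : u₀.1 + u₀.2 = 1) (hS : S ≠ 0)
    (hσ : 1 / 2 < ratio a c S) :
    ∀ᵐ ω ∂μ, ∃ x : ℝ, Tendsto (fun n => normalized a b c S U n ω) atTop (𝓝 x) := by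
  have hS0 : (0 : ℝ) < S := by exact_mod_cast Nat.pos_of_ne_zero hS
  have hm : (0 : ℝ) ≤ (a : ℝ) - c := by
    have : 0 < ((a : ℝ) - c) / S := lt_trans (by norm_num) hσ
    exact ((div_pos_iff_of_pos_right hS0).1 this).le
  have hsum := summable_inv_growth_sq hm hS hσ
  set R : ℝ := u₂ b c S u₀ ^ 2 + (u₂ b c S (a, b) ^ 2 + u₂ b c S (c, d) ^ 2) *
        ∑' j, 1 / growth ((a : ℝ) - c) S j ^ 2 with hR
  have hL2 : ∀ n, ∫ ω, urnMartingale a b c S U n ω ^ 2 ∂μ ≤ R := by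
    intro n
    refine (hU.integral_urnMartingale_sq_le hab hcd hu₀ hm n).trans ?_
    have := hsum.sum_le_tsum (Finset.range (n + 1)) fun j _ => by positivity
    rw [hR]
    gcongr
  have hL1 : ∀ n, eLpNorm (urnMartingale a b c S U n) 1 μ ≤ ((1 + R).toNNReal : ℝ≥0∞) := by
    intro n
    have hi : Integrable (urnMartingale a b c S U n) μ :=
      (hU.integrable_comp hab hcd (u₂ b c S) n).div_const _
    have hi2 : Integrable (fun ω => urnMartingale a b c S U n ω ^ 2) μ :=
      hU.integrable_comp hab hcd (fun v => (u₂ b c S v / growth ((a : ℝ) - c) S n) ^ 2) n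
    rw [eLpNorm_one_eq_lintegral_enorm, ← ofReal_integral_norm_eq_lintegral_enorm hi]
    refine ENNReal.ofReal_le_ofReal ?_
    calc ∫ ω, ‖urnMartingale a b c S U n ω‖ ∂μ
        ≤ ∫ ω, (1 + urnMartingale a b c S U n ω ^ 2) ∂μ := by
          refine integral_mono hi.norm ((integrable_const _).add hi2) fun ω => ?_
          simp only [Real.norm_eq_abs]
          nlinarith [sq_abs (urnMartingale a b c S U n ω),
            sq_nonneg (|urnMartingale a b c S U n ω| - 1)]
      _ = 1 + ∫ ω, urnMartingale a b c S U n ω ^ 2 ∂μ := by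
          rw [integral_add (integrable_const _) hi2]; simp
      _ ≤ 1 + R := by linarith [hL2 n]
  obtain ⟨C, -, hC⟩ := exists_tendsto_growth_div_rpow hm hS
  filter_upwards [(hU.martingale hab hcd hu₀ hm).submartingale.exists_ae_tendsto_of_bdd hL1]
    with ω ⟨x, hx⟩
  refine ⟨x * C, (hx.mul hC).congr fun n => ?_⟩
  have := (growth_pos (S := S) hm n).ne'
  simp only [urnMartingale, normalized, ratio]
  field_simp

end convergence

/-! ### Estimates for characteristic functions -/

lemma continuous_charFun_real (ρ : Measure ℝ) [IsFiniteMeasure ρ] : Continuous (charFun ρ) := by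
  have h : charFun ρ = fun t : ℝ => ∫ x, Complex.exp (t * x * Complex.I) ∂ρ := by
    ext t; exact charFun_apply_real t
  rw [h]
  refine continuous_of_dominated (bound := fun _ => 1) (fun t => ?_) (fun t => ?_)
    (integrable_const _) ?_
  · exact Measurable.aestronglyMeasurable (by fun_prop)
  · refine Eventually.of_forall fun x => ?_
    rw [← Complex.ofReal_mul, Complex.norm_exp_ofReal_mul_I]
  · exact Eventually.of_forall fun x => by fun_prop

lemma norm_exp_mul_I_sub_le (x y : ℝ) :
    ‖Complex.exp (x * Complex.I) - Complex.exp (y * Complex.I)‖ ≤ min 2 |x - y| := by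
  refine le_min ?_ ?_
  · refine (norm_sub_le _ _).trans ?_
    rw [Complex.norm_exp_ofReal_mul_I, Complex.norm_exp_ofReal_mul_I]
    norm_num
  · have h : Complex.exp (x * Complex.I) - Complex.exp (y * Complex.I)
        = Complex.exp (y * Complex.I) * (Complex.exp (Complex.I * ((x - y : ℝ) : ℂ)) - 1) := by
      rw [mul_sub, ← Complex.exp_add, mul_one]
      congr 2
      push_cast; ring
    rw [h, norm_mul, Complex.norm_exp_ofReal_mul_I, one_mul]
    exact Real.norm_exp_I_mul_ofReal_sub_one_le

lemma norm_prod_sub_prod_le {ι : Type*} (s : Finset ι) (z w : ι → ℂ)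
    (hz : ∀ i, ‖z i‖ ≤ 1) (hw : ∀ i, ‖w i‖ ≤ 1) :
    ‖∏ i ∈ s, z i - ∏ i ∈ s, w i‖ ≤ ∑ i ∈ s, ‖z i - w i‖ := by
  classical
  induction s using Finset.induction_on with
  | empty => simp
  | insert i s hi ih =>
    rw [Finset.prod_insert hi, Finset.prod_insert hi, Finset.sum_insert hi]
    have e : z i * ∏ j ∈ s, z j - w i * ∏ j ∈ s, w j
        = (z i - w i) * ∏ j ∈ s, z j + w i * (∏ j ∈ s, z j - ∏ j ∈ s, w j) := by ring
    rw [e]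
    refine (norm_add_le _ _).trans (add_le_add ?_ ?_)
    · rw [norm_mul]
      refine mul_le_of_le_one_right (norm_nonneg _) ?_
      rw [norm_prod]
      exact Finset.prod_le_one (fun j _ => norm_nonneg _) fun j _ => hz j
    · rw [norm_mul]
      exact (mul_le_of_le_one_left (norm_nonneg _) (hw i)).trans ih

/-- The character `u ↦ exp (i t u₂(u))`. -/
noncomputable def u₂Char (b c S : ℕ) (t : ℝ) (u : ℕ × ℕ) : ℂ :=
  Complex.exp ((t * u₂ b c S u : ℝ) * Complex.I)

lemma u₂Char_eq_pow_mul_pow (b c S : ℕ) (t : ℝ) (x y : ℕ) :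
    u₂Char b c S t (x, y) = u₂Char b c S t (1, 0) ^ x * u₂Char b c S t (0, 1) ^ y := by
  simp only [u₂Char]
  rw [← Complex.exp_nat_mul, ← Complex.exp_nat_mul, ← Complex.exp_add]
  congr 1
  simp only [u₂]
  push_cast
  ring

/-! ### Characteristic functions of the rescaled urn -/

section limit

variable {Ω : Type*} [MeasurableSpace Ω] {μ : Measure Ω} {a b c d S : ℕ} {u₀ : ℕ × ℕ}
  {U : ℕ → Ω → ℕ × ℕ} {W : Ω → ℝ}

lemma IsUrnProcess.measurable_u₂ (hU : IsUrnProcess a b c d u₀ U μ) (n : ℕ) :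
    Measurable fun ω => u₂ b c S (U n ω) :=
  (measurable_of_countable (u₂ b c S)).comp (hU.measurable n)

lemma IsUrnProcess.measurable_normalized (hU : IsUrnProcess a b c d u₀ U μ) (n : ℕ) :
    Measurable (normalized a b c S U n) :=
  (hU.measurable_u₂ n).div_const _

lemma IsUrnProcess.aemeasurable_limit (hU : IsUrnProcess a b c d u₀ U μ)
    (hW : ∀ᵐ ω ∂μ, Tendsto (fun n => normalized a b c S U n ω) atTop (𝓝 (W ω))) :
    AEMeasurable W μ :=
  aemeasurable_of_tendsto_metrizable_ae atTop (fun n => (hU.measurable_normalized n).aemeasurable)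
    hW

lemma charFun_map_eq {W : Ω → ℝ} (hW : AEMeasurable W μ) (t : ℝ) :
    charFun (μ.map W) t = ∫ ω, Complex.exp ((t * W ω : ℝ) * Complex.I) ∂μ := by
  rw [charFun_apply_real, integral_map hW (Measurable.aestronglyMeasurable (by fun_prop))]
  push_cast
  rfl

variable [IsProbabilityMeasure μ]

lemma IsUrnProcess.iterate_transfer_u₂Char (hU : IsUrnProcess a b c d u₀ U μ)
    (hab : a + b = S) (hcd : c + d = S) (n : ℕ) (t : ℝ) :
    (transfer a b c d)^[n] (u₂Char b c S t) u₀
      = charFun (μ.map fun ω => u₂ b c S (U n ω)) t := by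
  rw [← hU.integral_comp hab hcd, charFun_map_eq (hU.measurable_u₂ n).aemeasurable]
  rfl

/-- Uniform convergence of the characteristic functions along the triangular array. -/
theorem IsUrnProcess.eventually_forall_le_norm_sub_lt (hU : IsUrnProcess a b c d u₀ U μ)
    (hab : a + b = S) (hcd : c + d = S) (hσ : 0 < ratio a c S)
    (hW : ∀ᵐ ω ∂μ, Tendsto (fun n => normalized a b c S U n ω) atTop (𝓝 (W ω)))
    (t : ℝ) {ε : ℝ} (hε : 0 < ε) :
    ∀ᶠ N : ℕ in atTop, ∀ j ≤ N,
      ‖(transfer a b c d)^[j] (u₂Char b c S (t / (N : ℝ) ^ ratio a c S)) u₀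
        - charFun (μ.map W) (t * ((j : ℝ) / N) ^ ratio a c S)‖ < ε := by
  set σ := ratio a c S with hσdef
  have hWm := hU.aemeasurable_limit hW
  have : IsProbabilityMeasure (μ.map W) := Measure.isProbabilityMeasure_map hWm
  have hu : ∀ j, Measurable fun ω => u₂ b c S (U j ω) := hU.measurable_u₂
  have hbm : ∀ j, AEStronglyMeasurable
      (fun ω => min 2 (|t| * |normalized a b c S U j ω - W ω|)) μ := by
    intro j
    have := (hU.measurable_normalized (S := S) j).aemeasurable (μ := μ)
    exact AEMeasurable.aestronglyMeasurable (by fun_prop)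
  have hbound : ∀ j, ∀ᵐ ω ∂μ, ‖min 2 (|t| * |normalized a b c S U j ω - W ω|)‖ ≤ 2 := by
    intro j
    refine Eventually.of_forall fun ω => ?_
    rw [Real.norm_of_nonneg (by positivity)]
    exact min_le_left _ _
  have hD : Tendsto (fun j => ∫ ω, min 2 (|t| * |normalized a b c S U j ω - W ω|) ∂μ) atTop
      (𝓝 0) := by
    have h := tendsto_integral_of_dominated_convergence (μ := μ) (f := fun _ => (0 : ℝ))
      (fun _ => (2 : ℝ)) hbm (integrable_const _) hbound ?_
    · simpa using h
    · filter_upwards [hW] with ω hω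
      have h1 : Tendsto (fun j => |t| * |normalized a b c S U j ω - W ω|) atTop (𝓝 0) := by
        have := ((hω.sub_const (W ω)).abs).const_mul |t|
        simpa using this
      have h2 := (tendsto_const_nhds (x := (2 : ℝ))).min h1
      simpa using h2
  -- For `j > J` the two variables differ by `t * (j / N) ^ σ` times the error at time `j`, and `(j
  -- / N) ^ σ ≤ 1` makes the bound independent of `N`. For the finitely many `j ≤ J` both arguments
  -- tend to `0`, so both characteristic functions tend to `1`.
  obtain ⟨J, hJ⟩ := eventually_atTop.1 (hD.eventually (gt_mem_nhds hε))
  have hNσ : Tendsto (fun N : ℕ => (N : ℝ) ^ σ) atTop atTop :=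
    (tendsto_rpow_atTop hσ).comp tendsto_natCast_atTop_atTop
  have hsmall : ∀ j ∈ Finset.range (J + 1), ∀ᶠ N : ℕ in atTop,
      ‖(transfer a b c d)^[j] (u₂Char b c S (t / (N : ℝ) ^ σ)) u₀
        - charFun (μ.map W) (t * ((j : ℝ) / N) ^ σ)‖ < ε := by
    intro j _
    simp_rw [hU.iterate_transfer_u₂Char hab hcd j]
    have : IsProbabilityMeasure (μ.map fun ω => u₂ b c S (U j ω)) :=
      Measure.isProbabilityMeasure_map (hu j).aemeasurable
    have h1 : Tendsto (fun N : ℕ => t / (N : ℝ) ^ σ) atTop (𝓝 0) :=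
      tendsto_const_nhds.div_atTop hNσ
    have h2 : Tendsto (fun N : ℕ => t * ((j : ℝ) / N) ^ σ) atTop (𝓝 0) := by
      have h3 : Tendsto (fun N : ℕ => (j : ℝ) / N) atTop (𝓝 0) :=
        tendsto_const_nhds.div_atTop tendsto_natCast_atTop_atTop
      have h4 := (h3.rpow_const (p := σ) (Or.inr hσ.le)).const_mul t
      rwa [Real.zero_rpow hσ.ne', mul_zero] at h4
    have h5 := (((continuous_charFun_real (μ.map fun ω => u₂ b c S (U j ω))).tendsto 0).comp
      h1).sub (((continuous_charFun_real (μ.map W)).tendsto 0).comp h2)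
    simp only [charFun_zero, probReal_univ, sub_self] at h5
    have h6 := h5.norm
    rw [norm_zero] at h6
    exact h6.eventually (gt_mem_nhds hε)
  filter_upwards [(Filter.eventually_all_finset _).2 hsmall, eventually_gt_atTop 0]
    with N hN hN0 j hj
  by_cases hjJ : j < J + 1
  · exact hN j (Finset.mem_range.2 hjJ)
  · refine lt_of_le_of_lt ?_ (hJ j (by omega))
    have hN0' : (0 : ℝ) < N := by exact_mod_cast hN0
    have hj0' : (0 : ℝ) < j := by exact_mod_cast (by omega : 0 < j)
    have hjN : (j : ℝ) / N ≤ 1 := by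
      rw [div_le_one hN0']; exact_mod_cast hj
    have hWc : AEStronglyMeasurable
        (fun ω => Complex.exp ((t * ((j : ℝ) / N) ^ σ * W ω : ℝ) * Complex.I)) μ :=
      AEMeasurable.aestronglyMeasurable (by fun_prop)
    have huc : AEStronglyMeasurable
        (fun ω => Complex.exp ((t / (N : ℝ) ^ σ * u₂ b c S (U j ω) : ℝ) * Complex.I)) μ := by
      have := hu j
      exact Measurable.aestronglyMeasurable (by fun_prop)
    have hone : ∀ g : Ω → ℝ, ∀ᵐ ω ∂μ, ‖Complex.exp ((g ω : ℂ) * Complex.I)‖ ≤ 1 :=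
      fun g => Eventually.of_forall fun ω => by rw [Complex.norm_exp_ofReal_mul_I]
    rw [hU.iterate_transfer_u₂Char hab hcd, charFun_map_eq (hu j).aemeasurable,
      charFun_map_eq hWm, ← integral_sub (Integrable.of_bound huc 1 (hone _))
        (Integrable.of_bound hWc 1 (hone _))]
    refine norm_integral_le_of_norm_le
      (Integrable.of_bound (hbm j) 2 (hbound j)) (Eventually.of_forall fun ω => ?_)
    refine (norm_exp_mul_I_sub_le _ _).trans (min_le_min le_rfl ?_)
    have e : t / (N : ℝ) ^ σ * u₂ b c S (U j ω) - t * ((j : ℝ) / N) ^ σ * W ω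
        = t * (((j : ℝ) / N) ^ σ * (normalized a b c S U j ω - W ω)) := by
      rw [normalized, ← hσdef, Real.div_rpow hj0'.le hN0'.le]
      have h1 := (Real.rpow_pos_of_pos hN0' σ).ne'
      have h2 := (Real.rpow_pos_of_pos hj0' σ).ne'
      field_simp
    rw [e, abs_mul, abs_mul]
    refine mul_le_mul_of_nonneg_left ?_ (abs_nonneg t)
    refine mul_le_of_le_one_left (abs_nonneg _) ?_
    rw [abs_of_nonneg (by positivity)]
    exact Real.rpow_le_one (by positivity) hjN hσ.le

/-- The scale is `N ^ σ` at time `N + 1`, since the first draw from a single ball is set aside; the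
ratio `((N + 1) / N) ^ σ` tends to `1`. -/
theorem IsUrnProcess.tendsto_iterate_transfer_succ (hU : IsUrnProcess a b c d u₀ U μ)
    (hab : a + b = S) (hcd : c + d = S)
    (hW : ∀ᵐ ω ∂μ, Tendsto (fun n => normalized a b c S U n ω) atTop (𝓝 (W ω))) (t : ℝ) :
    Tendsto (fun N : ℕ =>
      (transfer a b c d)^[N + 1] (u₂Char b c S (t / (N : ℝ) ^ ratio a c S)) u₀) atTop
      (𝓝 (charFun (μ.map W) t)) := by
  set σ := ratio a c S with hσdef
  have hu : ∀ j, Measurable fun ω => u₂ b c S (U j ω) := hU.measurable_u₂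
  simp_rw [hU.iterate_transfer_u₂Char hab hcd, charFun_map_eq (hu _).aemeasurable,
    charFun_map_eq (hU.aemeasurable_limit hW)]
  refine tendsto_integral_of_dominated_convergence (fun _ => 1) (fun N => ?_) (integrable_const _)
    (fun N => Eventually.of_forall fun ω => by rw [Complex.norm_exp_ofReal_mul_I]) ?_
  · have := hu (N + 1)
    exact Measurable.aestronglyMeasurable (by fun_prop)
  · filter_upwards [hW] with ω hω
    have h1 : Tendsto (fun N : ℕ => (((N + 1 : ℕ) : ℝ) / N) ^ σ) atTop (𝓝 1) := by
      have h2 : Tendsto (fun N : ℕ => ((N + 1 : ℕ) : ℝ) / N) atTop (𝓝 1) := by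
        have h3 : Tendsto (fun N : ℕ => 1 + 1 / (N : ℝ)) atTop (𝓝 (1 + 0)) :=
          tendsto_const_nhds.add tendsto_one_div_atTop_nhds_zero_nat
        rw [add_zero] at h3
        refine h3.congr' ?_
        filter_upwards [eventually_ne_atTop 0] with N hN
        have : (N : ℝ) ≠ 0 := by exact_mod_cast hN
        push_cast
        field_simp
      have h4 := h2.rpow_const (p := σ) (Or.inl one_ne_zero)
      rwa [Real.one_rpow] at h4
    have h5 : Tendsto (fun N : ℕ => t / (N : ℝ) ^ σ * u₂ b c S (U (N + 1) ω)) atTop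
        (𝓝 (t * W ω)) := by
      have h6 := (h1.mul (hω.comp (tendsto_add_atTop_nat 1))).const_mul t
      rw [one_mul] at h6
      refine h6.congr' ?_
      filter_upwards [eventually_gt_atTop 0] with N hN
      have hN' : (0 : ℝ) < N := by exact_mod_cast hN
      have hN1 : (0 : ℝ) < ((N + 1 : ℕ) : ℝ) := by positivity
      simp only [Function.comp_apply, normalized, ← hσdef]
      rw [Real.div_rpow hN1.le hN'.le]
      have h1 := (Real.rpow_pos_of_pos hN' σ).ne'
      have h2 := (Real.rpow_pos_of_pos hN1 σ).ne'
      field_simp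
    have hc : Continuous fun x : ℝ => Complex.exp ((x : ℂ) * Complex.I) := by fun_prop
    exact (hc.tendsto _).comp h5

end limit

/-! ### The smoothing equation -/

section smoothing

lemma isProbabilityMeasure_dirichletMeasure {n : ℕ} {ν : Fin (n + 1) → ℝ} (hν : ∀ k, 0 < ν k) :
    IsProbabilityMeasure (dirichletMeasure ν) := by
  refine ⟨?_⟩
  have h := lintegral_dirichletMeasure_monomial hν fun _ => 0
  simpa using h

/-- The Dirichlet mixture of the multinomial weights. -/
lemma integral_multinomialWeight {n : ℕ} {ν : Fin (n + 1) → ℝ} (hν : ∀ k, 0 < ν k)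
    (l : Fin (n + 1) → ℕ) :
    ∫ v, multinomialWeight v l ∂(dirichletMeasure ν) = Nat.multinomial Finset.univ l *
      ((∏ k, (ascPochhammer ℝ (l k)).eval (ν k)) /
        (ascPochhammer ℝ (∑ k, l k)).eval (∑ k, ν k)) := by
  simp only [multinomialWeight]
  rw [integral_const_mul, integral_dirichletMeasure_monomial hν]

lemma integrable_multinomialWeight {n : ℕ} {ν : Fin (n + 1) → ℝ} (hν : ∀ k, 0 < ν k)
    (l : Fin (n + 1) → ℕ) :
    Integrable (fun v => multinomialWeight v l) (dirichletMeasure ν) := by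
  have := isProbabilityMeasure_dirichletMeasure hν
  refine Integrable.const_mul (Integrable.of_bound
    (Measurable.aestronglyMeasurable (by fun_prop)) 1 ?_) _
  filter_upwards [ae_dirichletMeasure_mem_stdSimplex ν] with v hv
  rw [Real.norm_of_nonneg (Finset.prod_nonneg fun k _ => pow_nonneg (hv.1 k) _)]
  refine Finset.prod_le_one (fun k _ => pow_nonneg (hv.1 k) _) fun k _ =>
    pow_le_one₀ (hv.1 k) ?_
  rw [← hv.2]
  exact Finset.single_le_sum (fun j _ => hv.1 j) (Finset.mem_univ k)

lemma tendsto_integral_bernsteinSimplex {n : ℕ} {ν : Fin (n + 1) → ℝ} (hν : ∀ k, 0 < ν k)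
    {f : (Fin (n + 1) → ℝ) → ℂ} (hf : ∀ x, ‖f x‖ ≤ 1) (hfc : Continuous f) :
    Tendsto (fun N => ∑ l ∈ Finset.piAntidiag Finset.univ N,
        ((∫ v, multinomialWeight v l ∂(dirichletMeasure ν) : ℝ) : ℂ) * f fun k => l k / N) atTop
      (𝓝 (∫ v, f v ∂(dirichletMeasure ν))) := by
  have := isProbabilityMeasure_dirichletMeasure hν
  have hint : ∀ N : ℕ, ∀ l ∈ Finset.piAntidiag (Finset.univ : Finset (Fin (n + 1))) N,
      Integrable (fun v => (multinomialWeight v l : ℂ) * f fun k => l k / N)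
        (dirichletMeasure ν) :=
    fun N l _ => (integrable_multinomialWeight hν l).ofReal.mul_const _
  have h : ∀ N : ℕ, ∑ l ∈ Finset.piAntidiag Finset.univ N,
        ((∫ v, multinomialWeight v l ∂(dirichletMeasure ν) : ℝ) : ℂ) * f (fun k => l k / N)
      = ∫ v, bernsteinSimplex f N v ∂(dirichletMeasure ν) := by
    intro N
    simp only [bernsteinSimplex]
    rw [integral_finsetSum _ (hint N)]
    refine Finset.sum_congr rfl fun l _ => ?_
    rw [integral_mul_const, integral_complex_ofReal]
  simp_rw [h]
  refine tendsto_integral_of_dominated_convergence (fun _ => 1) (fun N => ?_) (integrable_const _)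
    (fun N => ?_) ?_
  · exact (integrable_finsetSum _ (hint N)).aestronglyMeasurable
  · filter_upwards [ae_dirichletMeasure_mem_stdSimplex ν] with v hv
    exact norm_bernsteinSimplex_le hf hv N
  · filter_upwards [ae_dirichletMeasure_mem_stdSimplex ν] with v hv
    exact tendsto_bernsteinSimplex hf hv hfc.continuousAt

variable {a b c d S r : ℕ}

/-- The smoothing equation in terms of characteristic functions. -/
theorem charFun_limit_eq_integral (hab : a + b = S) (hcd : c + d = S) (hS : S ≠ 0)
    (hσ : 0 < ratio a c S) (hr : r ≤ S + 1)
    {Ω₀ : Type*} [MeasurableSpace Ω₀] {μ₀ : Measure Ω₀} [IsProbabilityMeasure μ₀]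
    {Ω₁ : Type*} [MeasurableSpace Ω₁] {μ₁ : Measure Ω₁} [IsProbabilityMeasure μ₁]
    {Ω₂ : Type*} [MeasurableSpace Ω₂] {μ₂ : Measure Ω₂} [IsProbabilityMeasure μ₂]
    {U₀ : ℕ → Ω₀ → ℕ × ℕ} {U₁ : ℕ → Ω₁ → ℕ × ℕ} {U₂ : ℕ → Ω₂ → ℕ × ℕ} {u₀ : ℕ × ℕ}
    (hU₀ : IsUrnProcess a b c d u₀ U₀ μ₀) (hU₁ : IsUrnProcess a b c d (1, 0) U₁ μ₁)
    (hU₂ : IsUrnProcess a b c d (0, 1) U₂ μ₂)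
    (hstart : ∀ f : ℕ × ℕ → ℂ, transfer a b c d f u₀ = f (r, S + 1 - r))
    {W : Ω₀ → ℝ} {X : Ω₁ → ℝ} {Y : Ω₂ → ℝ}
    (hW : ∀ᵐ ω ∂μ₀, Tendsto (fun n => normalized a b c S U₀ n ω) atTop (𝓝 (W ω)))
    (hX : ∀ᵐ ω ∂μ₁, Tendsto (fun n => normalized a b c S U₁ n ω) atTop (𝓝 (X ω)))
    (hY : ∀ᵐ ω ∂μ₂, Tendsto (fun n => normalized a b c S U₂ n ω) atTop (𝓝 (Y ω))) (t : ℝ) :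
    charFun (μ₀.map W) t = ∫ v, ∏ k : Fin (S + 1),
      charFun (if (k : ℕ) < r then μ₁.map X else μ₂.map Y) (t * v k ^ ratio a c S)
        ∂(dirichletMeasure fun _ : Fin (S + 1) => 1 / (S : ℝ)) := by
  set σ := ratio a c S with hσdef
  have hS0 : (0 : ℝ) < S := by exact_mod_cast Nat.pos_of_ne_zero hS
  have hν : ∀ _k : Fin (S + 1), (0 : ℝ) < 1 / S := fun _ => by positivity
  have hXp := Measure.isProbabilityMeasure_map (hU₁.aemeasurable_limit hX)
  have hYp := Measure.isProbabilityMeasure_map (hU₂.aemeasurable_limit hY)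
  set ρ : Fin (S + 1) → Measure ℝ := fun k => if (k : ℕ) < r then μ₁.map X else μ₂.map Y with hρ
  have hρp : ∀ k, IsProbabilityMeasure (ρ k) := by
    intro k; simp only [hρ]; split_ifs <;> assumption
  have hDir := isProbabilityMeasure_dirichletMeasure hν
  set Φ : (Fin (S + 1) → ℝ) → ℂ := fun v => ∏ k, charFun (ρ k) (t * v k ^ σ) with hΦ
  have hΦ1 : ∀ v, ‖Φ v‖ ≤ 1 := by
    intro v
    simp only [hΦ]
    rw [norm_prod]
    exact Finset.prod_le_one (fun k _ => norm_nonneg _) fun k _ => norm_charFun_le_one _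
  have hΦc : Continuous Φ := by
    refine continuous_finsetProd _ fun k _ => (continuous_charFun_real (ρ k)).comp ?_
    exact continuous_const.mul ((continuous_apply k).rpow_const fun _ => Or.inr hσ.le)
  have hlim := tendsto_integral_bernsteinSimplex hν hΦ1 hΦc
  -- One sequence, two limits: it converges to the characteristic function of `W`, and it is
  -- asymptotically the Dirichlet integral of the Bernstein operator applied to `Φ`.
  refine tendsto_nhds_unique (hU₀.tendsto_iterate_transfer_succ hab hcd hW t) ?_
  refine (tendsto_iff_of_dist ?_).2 hlim
  rw [Metric.tendsto_atTop]
  intro ε hε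
  -- Each of the `S + 1` factors may be off by this much, so the products differ by at most `ε / 2`;
  -- averaging with weights of sum one keeps the bound.
  have hε' : 0 < ε / (2 * (S + 1)) := by positivity
  obtain ⟨N₀, hN₀⟩ := eventually_atTop.1
    ((hU₁.eventually_forall_le_norm_sub_lt hab hcd hσ hX t hε').and
      (hU₂.eventually_forall_le_norm_sub_lt hab hcd hσ hY t hε'))
  refine ⟨N₀, fun N hN => ?_⟩
  obtain ⟨h1, h2⟩ := hN₀ N hN
  have hw0 : ∀ l : Fin (S + 1) → ℕ,
      0 ≤ ∫ v, multinomialWeight v l ∂(dirichletMeasure fun _ : Fin (S + 1) => 1 / (S : ℝ)) :=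
    fun l => integral_nonneg_of_ae
      ((ae_dirichletMeasure_mem_stdSimplex _).mono fun v hv => multinomialWeight_nonneg hv l)
  have hw1 : ∑ l ∈ Finset.piAntidiag Finset.univ N,
      ∫ v, multinomialWeight v l ∂(dirichletMeasure fun _ : Fin (S + 1) => 1 / (S : ℝ)) = 1 := by
    rw [← integral_finsetSum _ fun l _ => integrable_multinomialWeight hν l,
      integral_congr_ae (g := fun _ => (1 : ℝ))
        ((ae_dirichletMeasure_mem_stdSimplex _).mono fun v hv => sum_multinomialWeight hv N),
      integral_const, probReal_univ, one_smul]
  -- The first draw is deterministic and leaves `S + 1` balls, `r` of them red; the other `N` draws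
  -- are shared among their families.
  have hexp : (transfer a b c d)^[N + 1] (u₂Char b c S (t / (N : ℝ) ^ σ)) u₀ =
      ∑ l ∈ Finset.piAntidiag Finset.univ N,
        ((∫ v, multinomialWeight v l
          ∂(dirichletMeasure fun _ : Fin (S + 1) => 1 / (S : ℝ)) : ℝ) : ℂ) *
        ∏ k : Fin (S + 1), (transfer a b c d)^[l k] (u₂Char b c S (t / (N : ℝ) ^ σ))
          (if (k : ℕ) < r then (1, 0) else (0, 1)) := by
    rw [Function.iterate_succ_apply', hstart,
      iterate_transfer_eq_sum hab hcd hS (u₂Char_eq_pow_mul_pow b c S _) hr]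
    refine Finset.sum_congr rfl fun l hl => ?_
    rw [integral_multinomialWeight hν, (Finset.mem_piAntidiag.1 hl).1]
  have hterm : ∀ l ∈ Finset.piAntidiag (Finset.univ : Finset (Fin (S + 1))) N,
      ‖∏ k : Fin (S + 1), (transfer a b c d)^[l k] (u₂Char b c S (t / (N : ℝ) ^ σ))
          (if (k : ℕ) < r then (1, 0) else (0, 1)) - Φ (fun k => l k / N)‖ ≤ ε / 2 := by
    intro l hl
    have hlN : ∀ k, l k ≤ N := fun k => by
      rw [← (Finset.mem_piAntidiag.1 hl).1]
      exact Finset.single_le_sum (fun _ _ => Nat.zero_le _) (Finset.mem_univ k)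
    have hone : ∀ k : Fin (S + 1), ‖(transfer a b c d)^[l k] (u₂Char b c S (t / (N : ℝ) ^ σ))
        (if (k : ℕ) < r then (1, 0) else (0, 1))‖ ≤ 1 := by
      intro k
      split_ifs
      · rw [hU₁.iterate_transfer_u₂Char hab hcd]
        have := Measure.isProbabilityMeasure_map
          (hU₁.measurable_u₂ (b := b) (c := c) (S := S) (l k)).aemeasurable (μ := μ₁)
        exact norm_charFun_le_one _
      · rw [hU₂.iterate_transfer_u₂Char hab hcd]
        have := Measure.isProbabilityMeasure_map
          (hU₂.measurable_u₂ (b := b) (c := c) (S := S) (l k)).aemeasurable (μ := μ₂)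
        exact norm_charFun_le_one _
    refine (norm_prod_sub_prod_le _ _ _ hone fun k => norm_charFun_le_one _).trans ?_
    calc _ ≤ ∑ _k : Fin (S + 1), ε / (2 * (S + 1)) := by
          refine Finset.sum_le_sum fun k _ => ?_
          by_cases hk : (k : ℕ) < r
          · simpa only [hρ, if_pos hk] using (h1 (l k) (hlN k)).le
          · simpa only [hρ, if_neg hk] using (h2 (l k) (hlN k)).le
      _ = ε / 2 := by
          rw [Finset.sum_const, Finset.card_univ, Fintype.card_fin, nsmul_eq_mul]
          push_cast
          field_simp
  rw [Real.dist_0_eq_abs, abs_of_nonneg dist_nonneg, dist_eq_norm, hexp, ← Finset.sum_sub_distrib]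
  calc _ ≤ ∑ l ∈ Finset.piAntidiag Finset.univ N,
      (∫ v, multinomialWeight v l ∂(dirichletMeasure fun _ : Fin (S + 1) => 1 / (S : ℝ)))
        * (ε / 2) := by
        refine norm_sum_le_of_le _ fun l hl => ?_
        rw [← mul_sub, norm_mul, Complex.norm_real, Real.norm_of_nonneg (hw0 l)]
        exact mul_le_mul_of_nonneg_left (hterm l hl) (hw0 l)
    _ = ε / 2 := by rw [← Finset.sum_mul, hw1, one_mul]
    _ < ε := half_lt_self hε

variable {Ω Ω₁ Ω₂ : Type*} [MeasurableSpace Ω] [MeasurableSpace Ω₁] [MeasurableSpace Ω₂]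
  {X : Ω₁ → ℝ} {μ₁ : Measure Ω₁} {Y : Ω₂ → ℝ} {μ₂ : Measure Ω₂}
  {V : Ω → Fin (S + 1) → ℝ} {Z : Fin (S + 1) → Ω → ℝ} {P : Measure Ω}

lemma IsCopyFamily.aemeasurable_Z (h : IsCopyFamily S r X μ₁ Y μ₂ V Z P) (k : Fin (S + 1)) :
    AEMeasurable (Z k) P := by
  by_cases hk : (k : ℕ) < r
  · exact (h.copy_X k hk).aemeasurable_fst
  · exact (h.copy_Y k (not_lt.1 hk)).aemeasurable_fst

lemma IsCopyFamily.map_Z (h : IsCopyFamily S r X μ₁ Y μ₂ V Z P) (k : Fin (S + 1)) :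
    P.map (Z k) = if (k : ℕ) < r then μ₁.map X else μ₂.map Y := by
  split_ifs with hk
  · exact (h.copy_X k hk).map_eq
  · exact (h.copy_Y k (not_lt.1 hk)).map_eq

lemma IsCopyFamily.aemeasurable_sum (h : IsCopyFamily S r X μ₁ Y μ₂ V Z P) (σ : ℝ) :
    AEMeasurable (fun ω => ∑ k, V ω k ^ σ * Z k ω) P := by
  refine Finset.aemeasurable_fun_sum _ fun k _ => ?_
  have h1 : AEMeasurable (fun ω => V ω k) P :=
    (measurable_pi_apply k).comp_aemeasurable h.law_V.aemeasurable
  exact (h1.pow_const σ).mul (h.aemeasurable_Z k)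

/-- The joint law of `V` and the copies is a product measure. With `V = v` fixed, the exponential of
the sum factors over the independent copies. -/
lemma IsCopyFamily.charFun_map_sum [IsProbabilityMeasure P]
    (h : IsCopyFamily S r X μ₁ Y μ₂ V Z P) (σ t : ℝ) :
    charFun (P.map fun ω => ∑ k, V ω k ^ σ * Z k ω) t = ∫ v, ∏ k : Fin (S + 1),
      charFun (if (k : ℕ) < r then μ₁.map X else μ₂.map Y) (t * v k ^ σ)
        ∂(dirichletMeasure fun _ : Fin (S + 1) => 1 / (S : ℝ)) := by
  have hZ := h.aemeasurable_Z
  have hV := h.law_V.aemeasurable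
  have hZ' : AEMeasurable (fun ω k => Z k ω) P := aemeasurable_pi_lambda _ hZ
  have hp : ∀ k, IsProbabilityMeasure (P.map (Z k)) :=
    fun k => Measure.isProbabilityMeasure_map (hZ k)
  have hDir : IsProbabilityMeasure (dirichletMeasure fun _ : Fin (S + 1) => 1 / (S : ℝ)) := by
    rw [← h.law_V.map_eq]; exact Measure.isProbabilityMeasure_map hV
  have hjoint : P.map (fun ω => (V ω, fun k => Z k ω)) =
      (dirichletMeasure fun _ : Fin (S + 1) => 1 / (S : ℝ)).prod
        (Measure.pi fun k => P.map (Z k)) := by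
    rw [(indepFun_iff_map_prod_eq_prod_map_map hV hZ').1 h.indep_V, h.law_V.map_eq,
      (iIndepFun_iff_map_fun_eq_pi_map hZ).1 h.indep_Z]
  set G : (Fin (S + 1) → ℝ) × (Fin (S + 1) → ℝ) → ℂ :=
    fun p => Complex.exp ((t * ∑ k, p.1 k ^ σ * p.2 k : ℝ) * Complex.I) with hG
  have hGm : Measurable G := by fun_prop
  rw [charFun_map_eq (h.aemeasurable_sum σ)]
  change ∫ ω, G (V ω, fun k => Z k ω) ∂P = _
  rw [← integral_map (f := G) (hV.prodMk hZ') hGm.aestronglyMeasurable, hjoint,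
    integral_prod _ (Integrable.of_bound hGm.aestronglyMeasurable 1
      (Eventually.of_forall fun p => by simp only [hG]; rw [Complex.norm_exp_ofReal_mul_I]))]
  refine integral_congr_ae (Eventually.of_forall fun v => ?_)
  simp only [← h.map_Z]
  simp_rw [charFun_apply_real]
  rw [← integral_fintype_prod_eq_prod
    (f := fun k (x : ℝ) => Complex.exp (((t * v k ^ σ : ℝ) : ℂ) * x * Complex.I))]
  refine integral_congr_ae (Eventually.of_forall fun z => ?_)
  simp only [hG]
  rw [← Complex.exp_sum]
  congr 1
  push_cast
  rw [Finset.mul_sum, Finset.sum_mul]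
  refine Finset.sum_congr rfl fun k _ => ?_
  ring

end smoothing

end PolyaUrn

/-! ### The system of equations in distribution -/

theorem mainTheorem7 (a b c d S : ℕ) (hab : a + b = S) (hcd : c + d = S)
    (hb : b ≠ 0) (hc : c ≠ 0) (hσ : 1 / 2 < PolyaUrn.ratio a c S)
    {Ω₁ : Type*} [MeasurableSpace Ω₁] (μ₁ : Measure Ω₁) [IsProbabilityMeasure μ₁]
    {Ω₂ : Type*} [MeasurableSpace Ω₂] (μ₂ : Measure Ω₂) [IsProbabilityMeasure μ₂]
    (U₁ : ℕ → Ω₁ → ℕ × ℕ) (hU₁ : PolyaUrn.IsUrnProcess a b c d (1, 0) U₁ μ₁)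
    (U₂ : ℕ → Ω₂ → ℕ × ℕ) (hU₂ : PolyaUrn.IsUrnProcess a b c d (0, 1) U₂ μ₂)
    (X : Ω₁ → ℝ) (hX : X = PolyaUrn.limitW a b c S U₁)
    (Y : Ω₂ → ℝ) (hY : Y = PolyaUrn.limitW a b c S U₂) :
    (∀ᵐ ω ∂μ₁, Tendsto (fun n => PolyaUrn.normalized a b c S U₁ n ω) atTop (𝓝 (X ω))) ∧
    (∀ᵐ ω ∂μ₂, Tendsto (fun n => PolyaUrn.normalized a b c S U₂ n ω) atTop (𝓝 (Y ω))) ∧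
    (∀ (Ω : Type*) [MeasurableSpace Ω] (P : Measure Ω) [IsProbabilityMeasure P]
      (V : Ω → Fin (S + 1) → ℝ) (Z : Fin (S + 1) → Ω → ℝ),
      PolyaUrn.IsCopyFamily S (a + 1) X μ₁ Y μ₂ V Z P →
      IdentDistrib X (fun ω => ∑ k, V ω k ^ PolyaUrn.ratio a c S * Z k ω) μ₁ P) ∧
    (∀ (Ω : Type*) [MeasurableSpace Ω] (P : Measure Ω) [IsProbabilityMeasure P]
      (V : Ω → Fin (S + 1) → ℝ) (Z : Fin (S + 1) → Ω → ℝ),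
      PolyaUrn.IsCopyFamily S c X μ₁ Y μ₂ V Z P →
      IdentDistrib Y (fun ω => ∑ k, V ω k ^ PolyaUrn.ratio a c S * Z k ω) μ₂ P) := by
  have hS : S ≠ 0 := by omega
  have hσ0 : 0 < PolyaUrn.ratio a c S := lt_trans (by norm_num) hσ
  have hXlim : ∀ᵐ ω ∂μ₁,
      Tendsto (fun n => PolyaUrn.normalized a b c S U₁ n ω) atTop (𝓝 (X ω)) := by
    filter_upwards [hU₁.ae_exists_tendsto_normalized hab hcd rfl hS hσ] with ω hω
    rw [hX]
    exact tendsto_nhds_limUnder hω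
  have hYlim : ∀ᵐ ω ∂μ₂,
      Tendsto (fun n => PolyaUrn.normalized a b c S U₂ n ω) atTop (𝓝 (Y ω)) := by
    filter_upwards [hU₂.ae_exists_tendsto_normalized hab hcd rfl hS hσ] with ω hω
    rw [hY]
    exact tendsto_nhds_limUnder hω
  have hXm := hU₁.aemeasurable_limit hXlim
  have hYm := hU₂.aemeasurable_limit hYlim
  have hXp := Measure.isProbabilityMeasure_map hXm
  have hYp := Measure.isProbabilityMeasure_map hYm
  refine ⟨hXlim, hYlim, ?_, ?_⟩
  · intro Ω _ P _ V Z h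
    refine ⟨hXm, h.aemeasurable_sum _, ?_⟩
    have := Measure.isProbabilityMeasure_map (h.aemeasurable_sum (PolyaUrn.ratio a c S))
    refine Measure.ext_of_charFun (funext fun t => ?_)
    rw [h.charFun_map_sum]
    refine PolyaUrn.charFun_limit_eq_integral hab hcd hS hσ0 (by omega) hU₁ hU₁ hU₂
      (fun f => ?_) hXlim hXlim hYlim t
    -- From one red ball the first draw leads to `(a + 1, b)`.
    have e : S + 1 - (a + 1) = b := by omega
    simp [PolyaUrn.transfer, e, add_comm]
  · intro Ω _ P _ V Z h
    refine ⟨hYm, h.aemeasurable_sum _, ?_⟩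
    have := Measure.isProbabilityMeasure_map (h.aemeasurable_sum (PolyaUrn.ratio a c S))
    refine Measure.ext_of_charFun (funext fun t => ?_)
    rw [h.charFun_map_sum]
    refine PolyaUrn.charFun_limit_eq_integral hab hcd hS hσ0 (by omega) hU₂ hU₁ hU₂
      (fun f => ?_) hYlim hXlim hYlim t
    -- From one black ball it leads to `(c, d + 1)`, so only `c` families start from a red ball.
    have e : S + 1 - c = d + 1 := by omega
    simp [PolyaUrn.transfer, e, add_comm]
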